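/- An ice quiver $Q$ is a finite quiver without loops or directed 2-cycles, each of whose vertices is either mutable or frozen, and with no arrows between frozen vertices (multiple arrows are allowed). It is acyclic if it has no directed cycle consisting only of mutable vertices. Let $A(Q)$ be the cluster algebra of $Q$ over $\mathbb{Z}$ with invertible frozen variables, that is, the subring of $\mathbb{Q}(x_v : v\in Q_0)$ generated by the inverses of the frozen variables and by the elements of all clusters reachable from the initial seed $((x_v)_{v\in Q_0},Q)$ by finite sequences of mutations at mutable vertices, with exchange relation $x_k'x_k=\prod_{k\to j}x_j+\prod_{j\to k}x_j$ (products over arrows). Let $\mathcal V_{\mathbb{F}_2}(A(Q))$ be the set of $\mathbb{F}_2$-algebra homomorphisms $\mathbb{F}_2\otimes_{\mathbb{Z}}A(Q)\to\mathbb{F}_2$. Let $Q$ be an acyclic ice quiver, and let $x$ be a mutable vertex that is a sink or a source of the mutable part of $Q$ (so either no arrow goes from $x$ to a mutable vertex, or no arrow goes from a mutable vertex to $x$). Let $Q^{-x}$ be the ice quiver obtained from $Q$ by deleting $x$, and let $Q^{-N(x)}$ be the one obtained by deleting $x$ and all vertices, mutable or frozen, adjacent to $x$. Then the three sets below are finite,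 and $$\#\mathcal V_{\mathbb{F}_2}(A(Q))=\#\mathcal V_{\mathbb{F}_2}(A(Q^{-x}))+2\,\#\mathcal V_{\mathbb{F}_2}(A(Q^{-N(x)})).$$ -/

import Mathlib

open scoped TensorProduct

/-- An ice quiver on the vertex set `V`, with `arr i j` the number of arrows `i → j`. Each vertex is
either mutable or frozen (i.e. not mutable). There are no loops, no directed 2-cycles and no arrows
between frozen vertices. -/
@[ext]
structure IceQuiver (V : Type*) where
  Mutable : V → Prop
  arr : V → V → ℕ
  no_loop : ∀ i, arr i i = 0
  no_two_cycle : ∀ i j, arr i j = 0 ∨ arr j i = 0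
  no_frozen_arrow : ∀ i j, ¬ Mutable i → ¬ Mutable j → arr i j = 0

namespace IceQuiver

variable {V : Type*} (Q : IceQuiver V)

/-- The full subquiver on the vertices satisfying `p`; that is, the other vertices are deleted,
together with all arrows incident to them. -/
def restrict (p : V → Prop) : IceQuiver {v // p v} where
  Mutable v := Q.Mutable v
  arr i j := Q.arr i j
  no_loop i := Q.no_loop i
  no_two_cycle i j := Q.no_two_cycle i j
  no_frozen_arrow i j := Q.no_frozen_arrow i j

/-- `Q^{-x}`: the vertex `x` is deleted. -/
def deleteVertex (x : V) : IceQuiver {v // v ≠ x} :=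
  Q.restrict fun v => v ≠ x

/-- `Q^{-N(x)}`: the vertex `x` is deleted, with all (mutable or frozen) vertices adjacent to it. -/
def deleteNeighbors (x : V) : IceQuiver {v // v ≠ x ∧ Q.arr v x = 0 ∧ Q.arr x v = 0} :=
  Q.restrict fun v => v ≠ x ∧ Q.arr v x = 0 ∧ Q.arr x v = 0

/-- There is no directed cycle that consists of mutable vertices only. -/
def Acyclic : Prop :=
  ∀ v, ¬ Relation.TransGen (fun i j => Q.Mutable i ∧ Q.Mutable j ∧ 0 < Q.arr i j) v v

/-- `x` is a sink of the mutable part: no arrow goes from `x` to a mutable vertex. -/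
def IsMutableSink (x : V) : Prop :=
  Q.Mutable x ∧ ∀ j, Q.Mutable j → Q.arr x j = 0

/-- `x` is a source of the mutable part: no arrow goes from a mutable vertex to `x`. -/
def IsMutableSource (x : V) : Prop :=
  Q.Mutable x ∧ ∀ j, Q.Mutable j → Q.arr j x = 0

open Classical in
/-- Quiver mutation at `k`: add an arrow `i → j` for every path `i → k → j`, unless `i` and `j` are
both frozen; reverse all arrows at `k`; cancel a maximal family of 2-cycles. The truncated
subtraction on `ℕ` performs the cancellation. -/
noncomputable def mutate (k : V) : IceQuiver V where
  Mutable := Q.Mutable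
  arr i j :=
    if i = k ∨ j = k then Q.arr j i
    else if ¬ Q.Mutable i ∧ ¬ Q.Mutable j then 0
    else (Q.arr i j + Q.arr i k * Q.arr k j) - (Q.arr j i + Q.arr j k * Q.arr k i)
  no_loop i := by
    have := Q.no_loop i
    split_ifs <;> simp [this]
  no_two_cycle i j := by
    have := Q.no_two_cycle i j
    by_cases h : i = k ∨ j = k
    · have h' : j = k ∨ i = k := h.symm
      simp only [h, h', if_true]
      exact this.symm
    · have h' : ¬ (j = k ∨ i = k) := fun t => h t.symm
      simp only [h, h', if_false]
      split_ifs
      · exact Or.inl rfl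
      · exact Or.inl rfl
      · exact Or.inr rfl
      · omega
  no_frozen_arrow i j hi hj := by
    have := Q.no_frozen_arrow j i hj hi
    split_ifs with h h'
    · exact this
    · rfl
    · exact absurd ⟨hi, hj⟩ h'

end IceQuiver

/-- The ambient field `ℚ(x_v : v ∈ V)`, purely transcendental over `ℤ`. -/
abbrev AmbientField (V : Type*) : Type _ := FractionRing (MvPolynomial V ℤ)

/-- A labelled cluster in the ambient field, together with an ice quiver. Such pairs are used only
when they are obtained by mutations from the initial seed of an ice quiver. -/
structure ClusterSeed (V : Type*) where
  cluster : V → AmbientField V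
  quiver : IceQuiver V

namespace ClusterSeed

variable {V : Type*} [Fintype V]

open Classical in
/-- Seed mutation at `k`: the variable `x_k` is replaced by the `x_k'` with
`x_k' x_k = ∏_{k → j} x_j + ∏_{j → k} x_j` (products over arrows), and the quiver is mutated. -/
noncomputable def mutate (S : ClusterSeed V) (k : V) : ClusterSeed V where
  cluster := Function.update S.cluster k
    ((∏ j, S.cluster j ^ S.quiver.arr k j + ∏ j, S.cluster j ^ S.quiver.arr j k) / S.cluster k)
  quiver := S.quiver.mutate k

/-- `T` is the mutation of `S` at some mutable vertex. -/
def MutatesTo (S T : ClusterSeed V) : Prop :=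
  ∃ k, S.quiver.Mutable k ∧ T = S.mutate k

end ClusterSeed

namespace IceQuiver

variable {V : Type*} (Q : IceQuiver V)

/-- The initial seed of `Q`, whose cluster consists of the variables `x_v`. -/
noncomputable def initialSeed : ClusterSeed V where
  cluster v := algebraMap (MvPolynomial V ℤ) (AmbientField V) (MvPolynomial.X v)
  quiver := Q

variable [Fintype V]

/-- The cluster algebra `A(Q)` over `ℤ`: the subring of the ambient field generated by the elements
of all clusters of seeds reachable from the initial one by a finite sequence of mutations (frozen
variables included), and by the inverses of the frozen variables. -/
noncomputable def clusterAlgebra : Subring (AmbientField V) :=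
  Subring.closure
    ({z | ∃ S : ClusterSeed V,
        Relation.ReflTransGen ClusterSeed.MutatesTo Q.initialSeed S ∧ ∃ v, z = S.cluster v} ∪
      {z | ∃ v, ¬ Q.Mutable v ∧ z = (Q.initialSeed.cluster v)⁻¹})

/-- The set of `𝔽`-points of the cluster variety `Spec (𝔽 ⊗_ℤ A(Q))`. -/
abbrev ClusterVariety (𝔽 : Type*) [Field 𝔽] : Type _ :=
  (𝔽 ⊗[ℤ] Q.clusterAlgebra) →ₐ[𝔽] 𝔽

end IceQuiver

/-!
Let `x_v` be the initial variables, `P_k` the exchange polynomial of a mutable vertex `k`, and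
`x_k' = P_k / x_k`. The theorem follows from a description of the points of the cluster variety of
an acyclic quiver over `𝔽₂`: they are the solutions `(a, a')` of the exchange relations
`a_k a_k' = P_k(a)` in `𝔽₂`, with `a_v = 1` at the frozen vertices (`clusterVarietyEquiv`).

Given the description, the count is elementary. Let `x` be a sink or a source of the mutable part.
Where `a_x = 1`, the value `a_x'` is determined by the others, which form a solution for `Q^{-x}`.
Where `a_x = 0`, the relation at `x` says that the two terms of `P_x` cancel; as one of them is
a product of frozen variables, both are `1`. So all neighbors of `x` have the value `1`, `a_x'` is
arbitrary, and what remains is a solution for `Q^{-N(x)}`.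

The description rests on two facts. First, by acyclicity the zeros of `a` form a set `I` of
pairwise non-adjacent mutable vertices (`ExchangeSolution.isIndependent_zeros`). Second, for such a
set `I` the cluster algebra is contained in the ring generated by `x_v` and `x_v⁻¹` for `v ∉ I` and
by `x_k` and `x_k'` for `k ∈ I` (`clusterAlgebra_le_chart`). A point with zero set `I` extends to
this ring, so it is determined by `(a, a')`. Conversely, a solution with zero set `I` is realized by
lifting it to the Gaussian integers, with `x_v = 1` for `v ∉ I` and `x_k x_k' = 2` for `k ∈ I`.

The second fact is deduced from the Laurent phenomenon: for every `J ⊆ I`, all cluster variables are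
Laurent polynomials in the cluster obtained by mutation at the vertices of `J`, and
`C[x, x⁻¹] ∩ C[x', x'⁻¹] = C[x, x']` for `x x' ∈ C` is applied to one vertex of `I` after the other.

The Laurent phenomenon (`seedAt_cluster_mem_ambientLaurent`) is proved by induction on the length of
a sequence `j, k, …` of mutations. By induction, the last cluster consists of Laurent polynomials in
the clusters obtained by the mutations at `j` and at `j, k, j`, which gives two denominators with
respect to the initial cluster: a power of `P_j`, and a monomial in the last two variables created
by the mutations at `j, k, j`. A frozen vertex attached to `j` makes `P_j` linear in a variable, so
that `P_j` is prime and divisibility by it can be tested by a substitution. As `P_j` turns out not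
to divide the other denominator, the last cluster consists of Laurent polynomials in the initial one
(`mem_ambientLaurent_of_framed`). The variable of the additional vertex is set to `1` in the end.
-/

/-! ### Exchange polynomials -/

namespace IceQuiver

variable {V : Type*}

/-- The variable `x_v` of the ambient field. -/
noncomputable def ambientX (v : V) : AmbientField V :=
  algebraMap (MvPolynomial V ℤ) (AmbientField V) (MvPolynomial.X v)

/-- The right-hand side `∏_{k → j} a_j + ∏_{j → k} a_j` of the exchange relation at `k`. -/
def exchange [Fintype V] {R : Type*} [CommSemiring R] (Q : IceQuiver V) (a : V → R) (k : V) : R :=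
  ∏ j, a j ^ Q.arr k j + ∏ j, a j ^ Q.arr j k

theorem map_exchange [Fintype V] {R S : Type*} [CommSemiring R] [CommSemiring S] (f : R →+* S)
    (Q : IceQuiver V) (a : V → R) (k : V) :
    f (Q.exchange a k) = Q.exchange (fun v => f (a v)) k := by
  simp [exchange, map_prod]

theorem exchange_congr [Fintype V] {R : Type*} [CommSemiring R] {Q Q' : IceQuiver V}
    {a a' : V → R} {k : V} (h₁ : ∀ i, Q.arr k i = Q'.arr k i) (h₂ : ∀ i, Q.arr i k = Q'.arr i k)
    (h : ∀ i, Q.arr k i ≠ 0 ∨ Q.arr i k ≠ 0 → a i = a' i) :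
    Q.exchange a k = Q'.exchange a' k := by
  unfold exchange
  congr 1 <;> refine Finset.prod_congr rfl fun i _ => ?_
  · rw [← h₁]
    by_cases h0 : Q.arr k i = 0
    · simp [h0]
    · rw [h i (Or.inl h0)]
  · rw [← h₂]
    by_cases h0 : Q.arr i k = 0
    · simp [h0]
    · rw [h i (Or.inr h0)]

theorem exchange_mem [Fintype V] {R : Type*} [CommRing R] (S : Subring R) (Q : IceQuiver V)
    {a : V → R} {k : V} (h : ∀ i, Q.arr k i ≠ 0 ∨ Q.arr i k ≠ 0 → a i ∈ S) :
    Q.exchange a k ∈ S := by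
  refine add_mem (prod_mem fun i _ => ?_) (prod_mem fun i _ => ?_)
  · by_cases h0 : Q.arr k i = 0
    · simp [h0]
    · exact pow_mem (h i (Or.inl h0)) _
  · by_cases h0 : Q.arr i k = 0
    · simp [h0]
    · exact pow_mem (h i (Or.inr h0)) _

/-! ### Specialization of rational functions -/

/-- The rational function `z` is defined at the point `s`, with value `w`: it can be written as
`f / g` with `g(s) ≠ 0` and `w = f(s) / g(s)`. -/
def Specializes {L : Type*} [Field L] (s : V → L) (z : AmbientField V) (w : L) : Prop :=
  ∃ f g : MvPolynomial V ℤ, MvPolynomial.aeval s g ≠ 0 ∧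
    z * algebraMap _ (AmbientField V) g = algebraMap _ (AmbientField V) f ∧
    w * MvPolynomial.aeval s g = MvPolynomial.aeval s f

namespace Specializes

variable {L : Type*} [Field L] {s : V → L} {z z' : AmbientField V} {w w' : L}

theorem algebraMap_aeval (f : MvPolynomial V ℤ) :
    Specializes s (algebraMap _ _ f) (MvPolynomial.aeval s f) :=
  ⟨f, 1, by simp⟩

theorem ambientX (v : V) : Specializes s (ambientX v) (s v) := by
  have := algebraMap_aeval (s := s) (MvPolynomial.X v)
  rwa [MvPolynomial.aeval_X] at this

theorem one : Specializes s 1 1 := by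
  have := algebraMap_aeval (s := s) 1
  rwa [map_one, map_one] at this

theorem zero : Specializes s 0 0 := by
  have := algebraMap_aeval (s := s) 0
  rwa [map_zero, map_zero] at this

theorem intCast (n : ℤ) : Specializes s (n : AmbientField V) (n : L) := by
  have := algebraMap_aeval (s := s) (n : MvPolynomial V ℤ)
  rwa [map_intCast, map_intCast] at this

theorem unique (h : Specializes s z w) (h' : Specializes s z w') : w = w' := by
  obtain ⟨f, g, hg, hz, hw⟩ := h
  obtain ⟨f', g', hg', hz', hw'⟩ := h'
  have key : f * g' = f' * g := by
    apply IsFractionRing.injective (MvPolynomial V ℤ) (AmbientField V)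
    rw [map_mul, map_mul, ← hz, ← hz']
    ring
  have key' := congrArg (MvPolynomial.aeval s) key
  rw [map_mul, map_mul, ← hw, ← hw'] at key'
  apply mul_right_cancel₀ (mul_ne_zero hg hg')
  linear_combination key'

theorem add (h : Specializes s z w) (h' : Specializes s z' w') :
    Specializes s (z + z') (w + w') := by
  obtain ⟨f, g, hg, hz, hw⟩ := h
  obtain ⟨f', g', hg', hz', hw'⟩ := h'
  refine ⟨f * g' + f' * g, g * g', ?_, ?_, ?_⟩
  · rw [map_mul]; exact mul_ne_zero hg hg'
  · simp only [map_mul, map_add, ← hz, ← hz']; ring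
  · simp only [map_mul, map_add, ← hw, ← hw']; ring

theorem mul (h : Specializes s z w) (h' : Specializes s z' w') :
    Specializes s (z * z') (w * w') := by
  obtain ⟨f, g, hg, hz, hw⟩ := h
  obtain ⟨f', g', hg', hz', hw'⟩ := h'
  refine ⟨f * f', g * g', ?_, ?_, ?_⟩
  · rw [map_mul]; exact mul_ne_zero hg hg'
  · simp only [map_mul, ← hz, ← hz']; ring
  · simp only [map_mul, ← hw, ← hw']; ring

theorem neg (h : Specializes s z w) : Specializes s (-z) (-w) := by
  obtain ⟨f, g, hg, hz, hw⟩ := h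
  refine ⟨-f, g, hg, ?_, ?_⟩
  · rw [map_neg, ← hz]; ring
  · rw [map_neg, ← hw]; ring

theorem sub (h : Specializes s z w) (h' : Specializes s z' w') :
    Specializes s (z - z') (w - w') := by
  rw [sub_eq_add_neg, sub_eq_add_neg]
  exact h.add h'.neg

theorem ne_zero (h : Specializes s z w) (hw : w ≠ 0) : z ≠ 0 := by
  rintro rfl
  exact hw (h.unique zero)

theorem inv (h : Specializes s z w) (hw0 : w ≠ 0) : Specializes s z⁻¹ w⁻¹ := by
  have hz0 := h.ne_zero hw0
  obtain ⟨f, g, hg, hz, hw⟩ := h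
  refine ⟨g, f, ?_, ?_, ?_⟩
  · rw [← hw]; exact mul_ne_zero hw0 hg
  · rw [← hz, inv_mul_cancel_left₀ hz0]
  · rw [← hw, inv_mul_cancel_left₀ hw0]

theorem div (h : Specializes s z w) (h' : Specializes s z' w') (hw : w' ≠ 0) :
    Specializes s (z / z') (w / w') := by
  rw [div_eq_mul_inv, div_eq_mul_inv]
  exact h.mul (h'.inv hw)

theorem pow (h : Specializes s z w) (n : ℕ) : Specializes s (z ^ n) (w ^ n) := by
  induction n with
  | zero => simpa using one
  | succ n ih => rw [pow_succ, pow_succ]; exact ih.mul h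

theorem prod {ι : Type*} (t : Finset ι) {a : ι → AmbientField V} {b : ι → L}
    (h : ∀ i ∈ t, Specializes s (a i) (b i)) :
    Specializes s (∏ i ∈ t, a i) (∏ i ∈ t, b i) := by
  classical
  induction t using Finset.induction_on with
  | empty => simpa using one
  | insert i t hi ih =>
    rw [Finset.prod_insert hi, Finset.prod_insert hi]
    exact (h i (by simp)).mul (ih fun j hj => h j (by simp [hj]))

theorem exchange [Fintype V] {W : Type*} [Fintype W] (Q : IceQuiver W) {a : W → AmbientField V}
    {b : W → L} (h : ∀ v, Specializes s (a v) (b v)) (k : W) :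
    Specializes s (Q.exchange a k) (Q.exchange b k) :=
  (prod _ fun v _ => (h v).pow _).add (prod _ fun v _ => (h v).pow _)

end Specializes

/-- The rational functions that are defined at `s`, with value in the subring `R`. -/
def specializingTo {L : Type*} [Field L] (s : V → L) (R : Subring L) :
    Subring (AmbientField V) where
  carrier := {z | ∃ w ∈ R, Specializes s z w}
  mul_mem' := by
    rintro _ _ ⟨w, hw, h⟩ ⟨w', hw', h'⟩
    exact ⟨_, mul_mem hw hw', h.mul h'⟩
  one_mem' := ⟨1, one_mem R, .one⟩
  add_mem' := by
    rintro _ _ ⟨w, hw, h⟩ ⟨w', hw', h'⟩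
    exact ⟨_, add_mem hw hw', h.add h'⟩
  zero_mem' := ⟨0, zero_mem R, .zero⟩
  neg_mem' := by
    rintro _ ⟨w, hw, h⟩
    exact ⟨_, neg_mem hw, h.neg⟩

theorem ambientX_ne_zero (v : V) : (ambientX v : AmbientField V) ≠ 0 :=
  (Specializes.ambientX (s := fun _ => (1 : ℚ)) v).ne_zero one_ne_zero

theorem exchange_ambientX_ne_zero [Fintype V] (Q : IceQuiver V) (k : V) :
    Q.exchange ambientX k ≠ 0 := by
  apply (Specializes.exchange Q (Specializes.ambientX (s := fun _ => (1 : ℚ))) k).ne_zero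
  simp [exchange]

/-- A substitution that is undone by a second application of it is injective on polynomials. -/
theorem aeval_injective_of_specializes {a : V → AmbientField V}
    (h : ∀ v, Specializes a (a v) (ambientX v)) :
    Function.Injective (MvPolynomial.aeval a : MvPolynomial V ℤ →ₐ[ℤ] AmbientField V) := by
  have key : ∀ f : MvPolynomial V ℤ,
      Specializes a (MvPolynomial.aeval a f) (algebraMap _ (AmbientField V) f) := by
    intro f
    induction f using MvPolynomial.induction_on with
    | C n =>
      have := Specializes.algebraMap_aeval (s := a) (MvPolynomial.C n)
      simpa [MvPolynomial.aeval_C] using this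
    | add p q hp hq => rw [map_add, map_add]; exact hp.add hq
    | mul_X p v hp =>
      rw [map_mul, map_mul, MvPolynomial.aeval_X]
      exact hp.mul (h v)
  rw [injective_iff_map_eq_zero]
  intro f hf
  have h1 := key f
  rw [hf] at h1
  have h2 := h1.unique Specializes.zero
  exact (map_eq_zero_iff _ (IsFractionRing.injective (MvPolynomial V ℤ) (AmbientField V))).1 h2

theorem exists_hom_of_specializes {a : V → AmbientField V}
    (h : ∀ v, Specializes a (a v) (ambientX v)) :
    ∃ φ : AmbientField V →+* AmbientField V, ∀ v, φ (ambientX v) = a v := by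
  refine ⟨IsFractionRing.lift
    (g := (MvPolynomial.aeval a : MvPolynomial V ℤ →ₐ[ℤ] AmbientField V).toRingHom)
    (aeval_injective_of_specializes h), fun v => ?_⟩
  rw [ambientX, IsFractionRing.lift_algebraMap]
  simp

end IceQuiver

/-! ### Seeds along sequences of mutations -/

namespace IceQuiver

variable {V : Type*}

theorem mutate_arr_self_left (Q : IceQuiver V) (k i : V) : (Q.mutate k).arr k i = Q.arr i k := by
  simp [mutate]

theorem mutate_arr_self_right (Q : IceQuiver V) (k i : V) : (Q.mutate k).arr i k = Q.arr k i := by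
  simp [mutate]

theorem mutate_arr (Q : IceQuiver V) {k i j : V} (hi : i ≠ k) (hj : j ≠ k)
    (h : Q.Mutable i ∨ Q.Mutable j) :
    (Q.mutate k).arr i j =
      (Q.arr i j + Q.arr i k * Q.arr k j) - (Q.arr j i + Q.arr j k * Q.arr k i) := by
  have h' : ¬ (¬ Q.Mutable i ∧ ¬ Q.Mutable j) := by tauto
  simp [mutate, hi, hj, h']

theorem mutate_mutate (Q : IceQuiver V) (k : V) : (Q.mutate k).mutate k = Q := by
  ext i j
  · rfl
  · by_cases hi : i = k
    · subst hi
      rw [mutate_arr_self_left, mutate_arr_self_right]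
    by_cases hj : j = k
    · subst hj
      rw [mutate_arr_self_right, mutate_arr_self_left]
    by_cases h : Q.Mutable i ∨ Q.Mutable j
    · rw [mutate_arr (Q.mutate k) hi hj h, mutate_arr Q hi hj h, mutate_arr Q hj hi h.symm]
      simp only [mutate_arr_self_left, mutate_arr_self_right]
      rw [mul_comm (Q.arr k i), mul_comm (Q.arr k j)]
      generalize Q.arr i k * Q.arr k j = p
      generalize Q.arr j k * Q.arr k i = q
      have := Q.no_two_cycle i j
      omega
    · push Not at h
      rw [Q.no_frozen_arrow i j h.1 h.2]
      exact no_frozen_arrow _ i j h.1 h.2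

theorem exchange_mutate_self [Fintype V] {R : Type*} [CommSemiring R] (Q : IceQuiver V) (a : V → R)
    (k : V) : (Q.mutate k).exchange a k = Q.exchange a k := by
  simp only [exchange, mutate_arr_self_left, mutate_arr_self_right]
  rw [add_comm]

end IceQuiver

namespace ClusterSeed

variable {V : Type*}

theorem eq_of_cluster_of_quiver {S T : ClusterSeed V} (h : ∀ v, S.cluster v = T.cluster v)
    (h' : S.quiver = T.quiver) : S = T := by
  cases S; cases T
  congr
  exact funext h

/-- The image of a seed under an endomorphism of the ambient field. -/
noncomputable def map (φ : AmbientField V →+* AmbientField V) (S : ClusterSeed V) :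
    ClusterSeed V where
  cluster v := φ (S.cluster v)
  quiver := S.quiver

variable [Fintype V]

theorem mutate_cluster_self (S : ClusterSeed V) (k : V) :
    (S.mutate k).cluster k = S.quiver.exchange S.cluster k / S.cluster k := by
  simp [mutate, IceQuiver.exchange]

theorem mutate_cluster_of_ne (S : ClusterSeed V) {k v : V} (h : v ≠ k) :
    (S.mutate k).cluster v = S.cluster v := by
  simp [mutate, h]

theorem map_mutate (φ : AmbientField V →+* AmbientField V) (S : ClusterSeed V) (k : V) :
    (S.map φ).mutate k = (S.mutate k).map φ := by
  refine ClusterSeed.eq_of_cluster_of_quiver (fun v => ?_) ?_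
  · by_cases hv : v = k
    · subst hv
      rw [mutate_cluster_self]
      simp [map, mutate_cluster_self, IceQuiver.map_exchange]
    · rw [mutate_cluster_of_ne _ hv]
      simp [map, mutate_cluster_of_ne _ hv]
  · rfl

theorem foldl_mutate_map (φ : AmbientField V →+* AmbientField V) (S : ClusterSeed V) (l : List V) :
    l.foldl mutate (S.map φ) = (l.foldl mutate S).map φ := by
  induction l generalizing S with
  | nil => rfl
  | cons k l ih => rw [List.foldl_cons, map_mutate, ih]; rfl

theorem mutate_mutate (S : ClusterSeed V) (k : V) (h : S.cluster k ≠ 0)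
    (h' : S.quiver.exchange S.cluster k ≠ 0) : (S.mutate k).mutate k = S := by
  refine ClusterSeed.eq_of_cluster_of_quiver (fun v => ?_) ?_
  · by_cases hv : v = k
    · subst hv
      rw [mutate_cluster_self, mutate_cluster_self]
      have : (S.mutate v).quiver.exchange (S.mutate v).cluster v =
          S.quiver.exchange S.cluster v := by
        have e := IceQuiver.exchange_mutate_self S.quiver (S.mutate v).cluster v
        refine e.trans (IceQuiver.exchange_congr (fun _ => rfl) (fun _ => rfl) fun i hi => ?_)
        refine mutate_cluster_of_ne _ ?_
        rintro rfl
        simp [S.quiver.no_loop] at hi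
      rw [this]
      field_simp
    · rw [mutate_cluster_of_ne _ hv, mutate_cluster_of_ne _ hv]
  · exact S.quiver.mutate_mutate k

end ClusterSeed

namespace IceQuiver

variable {V : Type*} [Fintype V]

/-- The seed obtained from the initial seed by mutating along a list of vertices. -/
noncomputable def seedAt (Q : IceQuiver V) (l : List V) : ClusterSeed V :=
  l.foldl ClusterSeed.mutate Q.initialSeed

theorem seedAt_concat (Q : IceQuiver V) (l : List V) (k : V) :
    Q.seedAt (l ++ [k]) = (Q.seedAt l).mutate k := by
  simp [seedAt]

theorem mutable_seedAt (Q : IceQuiver V) (l : List V) :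
    (Q.seedAt l).quiver.Mutable = Q.Mutable := by
  induction l using List.reverseRecOn with
  | nil => rfl
  | append_singleton l k ih => rw [seedAt_concat]; exact ih

theorem mutate_cluster_specializes (Q : IceQuiver V) (k v : V) :
    Specializes (Q.initialSeed.mutate k).cluster ((Q.initialSeed.mutate k).cluster v)
      (ambientX v) := by
  by_cases hv : v = k
  · subst hv
    have h1 := Specializes.ambientX (s := (Q.initialSeed.mutate v).cluster) v
    have h2 := Specializes.exchange Q
      (Specializes.ambientX (s := (Q.initialSeed.mutate v).cluster)) v
    have hc : (Q.initialSeed.mutate v).cluster v = Q.exchange ambientX v / ambientX v :=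
      ClusterSeed.mutate_cluster_self _ _
    have he : Q.exchange (Q.initialSeed.mutate v).cluster v = Q.exchange ambientX v := by
      refine exchange_congr (fun _ => rfl) (fun _ => rfl) fun i hi => ?_
      refine ClusterSeed.mutate_cluster_of_ne _ ?_
      rintro rfl
      simp [Q.no_loop] at hi
    rw [he] at h2
    rw [hc] at h1
    have hP := exchange_ambientX_ne_zero Q v
    have hX := ambientX_ne_zero v
    have h3 := h2.div h1 (div_ne_zero hP hX)
    rw [← hc] at h3
    convert h3 using 1
    rw [hc]
    field_simp
  · have h1 := Specializes.ambientX (s := (Q.initialSeed.mutate k).cluster) v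
    rw [ClusterSeed.mutate_cluster_of_ne _ hv] at h1 ⊢
    exact h1

/-- Every cluster is the image of the initial one under an endomorphism of the ambient field. -/
theorem exists_hom_seedAt (Q : IceQuiver V) (l : List V) :
    ∃ φ : AmbientField V →+* AmbientField V, ∀ v, φ (ambientX v) = (Q.seedAt l).cluster v := by
  induction l generalizing Q with
  | nil => exact ⟨RingHom.id _, fun v => rfl⟩
  | cons k l ih =>
    obtain ⟨φ, hφ⟩ := exists_hom_of_specializes (mutate_cluster_specializes Q k)
    obtain ⟨χ, hχ⟩ := ih (Q.mutate k)
    refine ⟨φ.comp χ, fun v => ?_⟩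
    have : Q.initialSeed.mutate k = (Q.mutate k).initialSeed.map φ := by
      refine ClusterSeed.eq_of_cluster_of_quiver (fun v => ?_) ?_
      · exact (hφ v).symm
      · rfl
    simp only [seedAt, List.foldl_cons, RingHom.comp_apply, hχ]
    rw [this, ClusterSeed.foldl_mutate_map]
    rfl

theorem seedAt_append (Q : IceQuiver V) (l l' : List V) {φ : AmbientField V →+* AmbientField V}
    (hφ : ∀ v, φ (ambientX v) = (Q.seedAt l).cluster v) :
    Q.seedAt (l ++ l') = ((Q.seedAt l).quiver.seedAt l').map φ := by
  have : Q.seedAt l = (Q.seedAt l).quiver.initialSeed.map φ := by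
    refine ClusterSeed.eq_of_cluster_of_quiver (fun v => ?_) ?_
    · exact (hφ v).symm
    · rfl
  rw [seedAt, List.foldl_append, ← seedAt, this, ClusterSeed.foldl_mutate_map]
  rfl

theorem seedAt_cluster_ne_zero (Q : IceQuiver V) (l : List V) (v : V) :
    (Q.seedAt l).cluster v ≠ 0 := by
  obtain ⟨φ, hφ⟩ := Q.exists_hom_seedAt l
  rw [← hφ]
  exact (map_ne_zero φ).2 (ambientX_ne_zero v)

theorem seedAt_exchange_ne_zero (Q : IceQuiver V) (l : List V) (k : V) :
    (Q.seedAt l).quiver.exchange (Q.seedAt l).cluster k ≠ 0 := by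
  obtain ⟨φ, hφ⟩ := Q.exists_hom_seedAt l
  rw [← funext hφ, ← map_exchange]
  exact (map_ne_zero φ).2 (exchange_ambientX_ne_zero _ k)

theorem seedAt_append_pair (Q : IceQuiver V) (l l' : List V) (k : V) :
    Q.seedAt (l ++ k :: k :: l') = Q.seedAt (l ++ l') := by
  have : ((Q.seedAt l).mutate k).mutate k = Q.seedAt l :=
    ClusterSeed.mutate_mutate _ k (Q.seedAt_cluster_ne_zero l k) (Q.seedAt_exchange_ne_zero l k)
  rw [seedAt, seedAt, List.foldl_append, List.foldl_append, ← seedAt, List.foldl_cons,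
    List.foldl_cons, this]

theorem seedAt_append_reverse (Q : IceQuiver V) (l l' : List V) :
    Q.seedAt (l ++ (l.reverse ++ l')) = Q.seedAt l' := by
  induction l using List.reverseRecOn generalizing l' with
  | nil => rfl
  | append_singleton l k ih =>
    have : l ++ [k] ++ ((l ++ [k]).reverse ++ l') = l ++ k :: k :: (l.reverse ++ l') := by simp
    rw [this, seedAt_append_pair, ih]

theorem exists_eq_seedAt (Q : IceQuiver V) {S : ClusterSeed V}
    (h : Relation.ReflTransGen ClusterSeed.MutatesTo Q.initialSeed S) :
    ∃ l : List V, (∀ k ∈ l, Q.Mutable k) ∧ S = Q.seedAt l := by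
  induction h with
  | refl => exact ⟨[], by simp, rfl⟩
  | tail _ hST ih =>
    obtain ⟨l, hl, rfl⟩ := ih
    obtain ⟨k, hk, rfl⟩ := hST
    rw [mutable_seedAt] at hk
    refine ⟨l ++ [k], ?_, (Q.seedAt_concat l k).symm⟩
    simp only [List.mem_append, List.mem_singleton]
    rintro i (hi | rfl)
    · exact hl i hi
    · exact hk

theorem reflTransGen_seedAt (Q : IceQuiver V) (l : List V) (hl : ∀ k ∈ l, Q.Mutable k) :
    Relation.ReflTransGen ClusterSeed.MutatesTo Q.initialSeed (Q.seedAt l) := by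
  induction l using List.reverseRecOn with
  | nil => exact .refl
  | append_singleton l k ih =>
    refine .tail (ih fun i hi => hl i (by simp [hi])) ⟨k, ?_, Q.seedAt_concat l k⟩
    rw [mutable_seedAt]
    exact hl k (by simp)

end IceQuiver

/-! ### The Laurent phenomenon -/

/-- The subring of `K` generated by the elements `a v` and their inverses. -/
def laurentRing {V K : Type*} [Field K] (a : V → K) : Subring K :=
  Subring.closure (Set.range a ∪ Set.range fun v => (a v)⁻¹)

/-- The elements of `K` that a power of `p ∈ R` multiplies into `R`. -/
def awayRing {K : Type*} [Field K] (R : Subring K) (p : K) (hp : p ∈ R) : Subring K where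
  carrier := {z | ∃ n : ℕ, p ^ n * z ∈ R}
  mul_mem' := by
    rintro a b ⟨m, ha⟩ ⟨n, hb⟩
    refine ⟨m + n, ?_⟩
    have := mul_mem ha hb
    rwa [show p ^ m * a * (p ^ n * b) = p ^ (m + n) * (a * b) by ring] at this
  one_mem' := ⟨0, by simp⟩
  add_mem' := by
    rintro a b ⟨m, ha⟩ ⟨n, hb⟩
    refine ⟨m + n, ?_⟩
    have := add_mem (mul_mem (pow_mem hp n) ha) (mul_mem (pow_mem hp m) hb)
    rwa [show p ^ n * (p ^ m * a) + p ^ m * (p ^ n * b) = p ^ (m + n) * (a + b) by ring] at this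
  zero_mem' := ⟨0, by simp⟩
  neg_mem' := by
    rintro a ⟨m, ha⟩
    refine ⟨m, ?_⟩
    rw [mul_neg]
    exact neg_mem ha

section LaurentRing

variable {V K : Type*} [Field K] {a : V → K}

theorem mem_laurentRing (v : V) : a v ∈ laurentRing a :=
  Subring.subset_closure (Or.inl ⟨v, rfl⟩)

theorem inv_mem_laurentRing (v : V) : (a v)⁻¹ ∈ laurentRing a :=
  Subring.subset_closure (Or.inr ⟨v, rfl⟩)

theorem laurentRing_le {R : Subring K} (h : ∀ v, a v ∈ R) (h' : ∀ v, (a v)⁻¹ ∈ R) :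
    laurentRing a ≤ R := by
  refine Subring.closure_le.2 ?_
  rintro _ (⟨v, rfl⟩ | ⟨v, rfl⟩)
  · exact h v
  · exact h' v

theorem map_mem_laurentRing {L : Type*} [Field L] (φ : K →+* L) {b : V → L}
    (h : ∀ v, φ (a v) = b v) {z : K} (hz : z ∈ laurentRing a) : φ z ∈ laurentRing b := by
  have : laurentRing a ≤ (laurentRing b).comap φ := by
    refine laurentRing_le (fun v => ?_) fun v => ?_
    · rw [Subring.mem_comap, h]; exact mem_laurentRing v
    · rw [Subring.mem_comap, map_inv₀, h]; exact inv_mem_laurentRing v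
  exact this hz

theorem le_awayRing {R : Subring K} {p : K} (hp : p ∈ R) : R ≤ awayRing R p hp :=
  fun z hz => ⟨0, by simpa using hz⟩

theorem prod_pow_eq_of_eq_off [Fintype V] [DecidableEq V] {R : Type*} [CommSemiring R]
    {a a' : V → R} {k : V} (h : ∀ v, v ≠ k → a' v = a v) (e : V → ℕ) :
    ∏ i, a' i ^ e i = a' k ^ e k * ∏ i, a i ^ (if i = k then 0 else e i) := by
  rw [← Finset.mul_prod_erase _ _ (Finset.mem_univ k),
    ← Finset.mul_prod_erase (a := k) _ (fun i => a i ^ (if i = k then 0 else e i))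
      (Finset.mem_univ k)]
  simp only [if_true, pow_zero, one_mul]
  congr 1
  refine Finset.prod_congr rfl fun i hi => ?_
  have hi := Finset.ne_of_mem_erase hi
  rw [h i hi, if_neg hi]

end LaurentRing

namespace IceQuiver

variable {V : Type*}

/-- The ring of Laurent polynomials in the initial variables. -/
noncomputable abbrev ambientLaurent (V : Type*) : Subring (AmbientField V) :=
  laurentRing (ambientX : V → AmbientField V)

/-- The invertible Laurent polynomials with value `1` or `-1` at the point `s`. -/
noncomputable def signUnits (s : V → ℚ) : Submonoid (AmbientField V) where
  carrier := {z | z ∈ ambientLaurent V ∧ z⁻¹ ∈ ambientLaurent V ∧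
    (Specializes s z 1 ∨ Specializes s z (-1))}
  one_mem' := ⟨one_mem _, by rw [inv_one]; exact one_mem _, Or.inl .one⟩
  mul_mem' := by
    rintro a b ⟨ha, ha', hs⟩ ⟨hb, hb', ht⟩
    refine ⟨mul_mem ha hb, by rw [mul_inv]; exact mul_mem ha' hb', ?_⟩
    rcases hs with hs | hs <;> rcases ht with ht | ht <;> have := hs.mul ht
    · left; simpa using this
    · right; simpa using this
    · right; simpa using this
    · left; simpa using this

theorem exists_value_of_mem_signUnits {s : V → ℚ} {z : AmbientField V} (h : z ∈ signUnits s) :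
    ∃ u : ℚ, (u = 1 ∨ u = -1) ∧ Specializes s z u := by
  rcases h.2.2 with hu | hu
  exacts [⟨1, Or.inl rfl, hu⟩, ⟨-1, Or.inr rfl, hu⟩]

theorem inv_mem_signUnits {s : V → ℚ} {z : AmbientField V} (h : z ∈ signUnits s) :
    z⁻¹ ∈ signUnits s := by
  obtain ⟨ha, ha', hs⟩ := h
  refine ⟨ha', by rwa [inv_inv], ?_⟩
  rcases hs with hs | hs
  · left; simpa using hs.inv one_ne_zero
  · right; simpa [inv_neg] using hs.inv (neg_ne_zero.2 one_ne_zero)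

theorem div_mem_signUnits {s : V → ℚ} {z w : AmbientField V} (h : z ∈ signUnits s)
    (h' : w ∈ signUnits s) : z / w ∈ signUnits s := by
  rw [div_eq_mul_inv]
  exact mul_mem h (inv_mem_signUnits h')

theorem ambientX_mem_signUnits {s : V → ℚ} {v : V} (h : s v = 1 ∨ s v = -1) :
    ambientX v ∈ signUnits s := by
  refine ⟨mem_laurentRing v, inv_mem_laurentRing v, ?_⟩
  have := Specializes.ambientX (s := s) v
  rcases h with h | h <;> rw [h] at this
  · exact Or.inl this
  · exact Or.inr this

theorem monomial_mem_signUnits [Fintype V] {s : V → ℚ} {e : V → ℕ}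
    (h : ∀ v, e v ≠ 0 → s v = 1 ∨ s v = -1) : ∏ v, ambientX v ^ e v ∈ signUnits s := by
  refine prod_mem fun v _ => ?_
  by_cases h0 : e v = 0
  · simp [h0]
  · exact pow_mem (ambientX_mem_signUnits (h v h0)) _

variable [Fintype V]

theorem exchange_ambientX_mem (Q : IceQuiver V) (k : V) :
    Q.exchange ambientX k ∈ ambientLaurent V :=
  exchange_mem _ _ fun _ _ => mem_laurentRing _

theorem seedAt_singleton_cluster_self (Q : IceQuiver V) (j : V) :
    (Q.seedAt [j]).cluster j = Q.exchange ambientX j / ambientX j :=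
  ClusterSeed.mutate_cluster_self _ _

theorem seedAt_singleton_cluster_of_ne (Q : IceQuiver V) {j v : V} (h : v ≠ j) :
    (Q.seedAt [j]).cluster v = ambientX v :=
  ClusterSeed.mutate_cluster_of_ne _ h

theorem seedAt_singleton_cluster_mem (Q : IceQuiver V) (j v : V) :
    (Q.seedAt [j]).cluster v ∈ ambientLaurent V := by
  by_cases h : v = j
  · subst h
    rw [seedAt_singleton_cluster_self, div_eq_mul_inv]
    exact mul_mem (exchange_ambientX_mem Q v) (inv_mem_laurentRing v)
  · rw [seedAt_singleton_cluster_of_ne Q h]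
    exact mem_laurentRing v

/-- The second mutation, in the case where no arrow goes from `k` to `j`. -/
theorem seedAt_pair_cluster (Q : IceQuiver V) [DecidableEq V] {j k : V} (hjk : j ≠ k)
    (h : Q.arr k j = 0) :
    (Q.seedAt [j, k]).cluster k =
      ((Q.exchange ambientX j / ambientX j) ^ Q.arr j k *
        (∏ i, ambientX i ^ (if i = j then 0 else (Q.mutate j).arr k i)) +
        ∏ i, ambientX i ^ (Q.mutate j).arr i k) / ambientX k := by
  have h0 : (Q.seedAt [j, k]).cluster k =
      (Q.mutate j).exchange (Q.seedAt [j]).cluster k / (Q.seedAt [j]).cluster k :=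
    ClusterSeed.mutate_cluster_self _ _
  have h1 : (Q.mutate j).arr j k = 0 := by rw [mutate_arr_self_left, h]
  rw [h0, seedAt_singleton_cluster_of_ne Q hjk.symm, exchange,
    prod_pow_eq_of_eq_off (fun v hv => Q.seedAt_singleton_cluster_of_ne hv),
    prod_pow_eq_of_eq_off (fun v hv => Q.seedAt_singleton_cluster_of_ne hv)
      (fun i => (Q.mutate j).arr i k),
    seedAt_singleton_cluster_self, mutate_arr_self_right, h1, pow_zero, one_mul]
  congr 2
  refine Finset.prod_congr rfl fun i _ => ?_
  split_ifs with hi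
  · rw [hi, h1]
  · rfl

/-- The monomials in the exchange relations along the mutations at `j`, `k`, `j`. -/
theorem exchange_monomials_relation (Q : IceQuiver V) [DecidableEq V] {R : Type*} [CommSemiring R]
    (a : V → R) {j k : V} (hjk : j ≠ k) (hj : Q.Mutable j) (h : Q.arr k j = 0) :
    (∏ i, a i ^ (if i = k then 0 else ((Q.mutate j).mutate k).arr i j)) *
        (∏ i, a i ^ Q.arr i j) * a k ^ Q.arr j k =
      (∏ i, a i ^ (if i = k then 0 else ((Q.mutate j).mutate k).arr j i)) *
        (∏ i, a i ^ (Q.mutate j).arr i k) ^ Q.arr j k * ∏ i, a i ^ Q.arr j i := by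
  have hk : a k ^ Q.arr j k = ∏ i, a i ^ (if i = k then Q.arr j k else 0) := by
    rw [Finset.prod_eq_single k] <;> simp +contextual
  rw [hk, ← Finset.prod_pow]
  simp only [← Finset.prod_mul_distrib, ← pow_mul, ← pow_add]
  refine Finset.prod_congr rfl fun i _ => ?_
  congr 1
  by_cases hik : i = k
  · subst hik
    simp [h, IceQuiver.no_loop]
  by_cases hij : i = j
  · subst hij
    simp [hik, IceQuiver.no_loop, mutate_arr_self_left, h]
  have hj' : (Q.mutate j).Mutable j := hj
  rw [if_neg hik, if_neg hik, if_neg hik, mutate_arr (Q.mutate j) hik hjk (Or.inr hj'),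
    mutate_arr (Q.mutate j) hjk hik (Or.inl hj'), mutate_arr_self_left, mutate_arr_self_left,
    mutate_arr_self_right, mutate_arr_self_right, h]
  have := Q.no_two_cycle i j
  rw [zero_mul]
  generalize (Q.mutate j).arr i k * Q.arr j k = p
  omega

/-- The third mutation: up to a unit `u`, the variable obtained by the mutations at `j`, `k`, `j` is
the initial variable `x_j`, plus a multiple of a power of `x_j'`. -/
theorem seedAt_triple_cluster (Q : IceQuiver V) [DecidableEq V] {j k : V} (hjk : j ≠ k)
    (hj : Q.Mutable j) (h : Q.arr k j = 0) :
    (Q.seedAt [j, k, j]).cluster j =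
      (∏ i, ambientX i ^ (if i = k then 0 else ((Q.mutate j).mutate k).arr j i)) *
        ((∏ i, ambientX i ^ (Q.mutate j).arr i k) / ambientX k) ^ Q.arr j k /
        (∏ i, ambientX i ^ Q.arr i j) * ambientX j +
      (∏ i, ambientX i ^ (if i = k then 0 else ((Q.mutate j).mutate k).arr j i)) *
        (((Q.seedAt [j, k]).cluster k ^ Q.arr j k -
          ((∏ i, ambientX i ^ (Q.mutate j).arr i k) / ambientX k) ^ Q.arr j k) /
        (Q.exchange ambientX j / ambientX j)) := by
  have h0 : (Q.seedAt [j, k, j]).cluster j =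
      ((Q.mutate j).mutate k).exchange (Q.seedAt [j, k]).cluster j /
        (Q.seedAt [j, k]).cluster j :=
    ClusterSeed.mutate_cluster_self _ _
  have hc : ∀ v, v ≠ k → (Q.seedAt [j, k]).cluster v = (Q.seedAt [j]).cluster v :=
    fun v hv => ClusterSeed.mutate_cluster_of_ne _ hv
  have hk0 : ((Q.mutate j).mutate k).arr k j = 0 := by
    rw [mutate_arr_self_left, mutate_arr_self_left, h]
  have hk1 : ((Q.mutate j).mutate k).arr j k = Q.arr j k := by
    rw [mutate_arr_self_right, mutate_arr_self_right]
  have h1 : ((Q.mutate j).mutate k).exchange (Q.seedAt [j, k]).cluster j =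
      (Q.seedAt [j, k]).cluster k ^ Q.arr j k *
        (∏ i, ambientX i ^ (if i = k then 0 else ((Q.mutate j).mutate k).arr j i)) +
        ∏ i, ambientX i ^ (if i = k then 0 else ((Q.mutate j).mutate k).arr i j) := by
    have e : ((Q.mutate j).mutate k).exchange (Q.seedAt [j, k]).cluster j =
        ((Q.mutate j).mutate k).exchange
          (Function.update ambientX k ((Q.seedAt [j, k]).cluster k)) j := by
      refine exchange_congr (fun _ => rfl) (fun _ => rfl) fun i hi => ?_
      have hij : i ≠ j := by
        rintro rfl
        simp [IceQuiver.no_loop] at hi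
      by_cases hik : i = k
      · rw [hik, Function.update_self]
      · rw [Function.update_of_ne hik, hc i hik, seedAt_singleton_cluster_of_ne Q hij]
    rw [e, exchange, prod_pow_eq_of_eq_off (fun v hv => Function.update_of_ne hv _ _),
      prod_pow_eq_of_eq_off (fun v hv => Function.update_of_ne hv _ _)
        (fun i => ((Q.mutate j).mutate k).arr i j), hk0, hk1, Function.update_self]
    simp
  rw [h0, h1, hc j hjk, seedAt_singleton_cluster_self]
  have hrel := Q.exchange_monomials_relation (ambientX : V → AmbientField V) hjk hj h
  have hX : ∀ e : V → ℕ, ∏ i, (ambientX i : AmbientField V) ^ e i ≠ 0 := fun e =>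
    Finset.prod_ne_zero_iff.2 fun i _ => pow_ne_zero _ (ambientX_ne_zero i)
  have hP := exchange_ambientX_ne_zero Q j
  have hPd : Q.exchange ambientX j =
      (∏ i, (ambientX i : AmbientField V) ^ Q.arr j i) + ∏ i, ambientX i ^ Q.arr i j := rfl
  have hin := hX fun i => Q.arr i j
  have hXj := ambientX_ne_zero j
  have hXk := pow_ne_zero (Q.arr j k) (ambientX_ne_zero k)
  rw [div_pow]
  generalize (Q.seedAt [j, k]).cluster k ^ Q.arr j k = y at *
  generalize (∏ i, (ambientX i : AmbientField V) ^
    (if i = k then 0 else ((Q.mutate j).mutate k).arr i j)) = F at *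
  generalize (∏ i, (ambientX i : AmbientField V) ^
    (if i = k then 0 else ((Q.mutate j).mutate k).arr j i)) = E at *
  generalize (∏ i, (ambientX i : AmbientField V) ^ (Q.mutate j).arr i k) ^ Q.arr j k = D at *
  generalize (ambientX k : AmbientField V) ^ Q.arr j k = xk at *
  generalize Q.exchange ambientX j = P at *
  generalize (∏ i, (ambientX i : AmbientField V) ^ Q.arr i j) = A at *
  generalize (∏ i, (ambientX i : AmbientField V) ^ Q.arr j i) = B at *
  field_simp
  linear_combination hrel - E * D * hPd

end IceQuiver

namespace IceQuiver

variable {V : Type*}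

/-- Mutation at `j` does not change the arrows at a mutable vertex that is not adjacent to `j`. -/
theorem mutate_arr_of_not_adj (Q : IceQuiver V) {j k : V} (hk : Q.Mutable k) (hjk : k ≠ j)
    (h : Q.arr j k = 0) (h' : Q.arr k j = 0) (i : V) :
    (Q.mutate j).arr k i = Q.arr k i ∧ (Q.mutate j).arr i k = Q.arr i k := by
  by_cases hi : i = j
  · subst hi
    rw [mutate_arr_self_left, mutate_arr_self_right, h, h']
    exact ⟨rfl, rfl⟩
  · rw [mutate_arr Q hjk hi (Or.inl hk), mutate_arr Q hi hjk (Or.inr hk), h, h']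
    have := Q.no_two_cycle i k
    simp only [zero_mul, mul_zero, add_zero]
    omega

variable [Fintype V]

theorem seedAt_pair_cluster_of_not_adj (Q : IceQuiver V) {j k : V} (hk : Q.Mutable k)
    (hjk : k ≠ j) (h : Q.arr j k = 0) (h' : Q.arr k j = 0) :
    (Q.seedAt [j, k]).cluster k = Q.exchange ambientX k / ambientX k := by
  have h0 : (Q.seedAt [j, k]).cluster k =
      (Q.mutate j).exchange (Q.seedAt [j]).cluster k / (Q.seedAt [j]).cluster k :=
    ClusterSeed.mutate_cluster_self _ _
  rw [h0, seedAt_singleton_cluster_of_ne Q hjk]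
  congr 1
  refine exchange_congr (fun i => (Q.mutate_arr_of_not_adj hk hjk h h' i).1)
    (fun i => (Q.mutate_arr_of_not_adj hk hjk h h' i).2) fun i hi => ?_
  refine seedAt_singleton_cluster_of_ne Q ?_
  rintro rfl
  rw [mutate_arr_self_left, mutate_arr_self_right, h, h'] at hi
  simp at hi

/-- `z` is a Laurent polynomial that does not vanish at `s`. -/
def LaurentNonvanishing (s : V → ℚ) (z : AmbientField V) : Prop :=
  z ∈ ambientLaurent V ∧ ∃ w, w ≠ 0 ∧ Specializes s z w

/-- At a point where the exchange polynomial of `j` vanishes, and where all variables except `x_j`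
are signs, the variables obtained by the mutations at `j`, `k` and `j`, `k`, `j` do not vanish. -/
theorem laurentNonvanishing_of_arr_eq_zero (Q : IceQuiver V) {j k : V} (hjk : j ≠ k)
    (hj : Q.Mutable j) (hk : Q.Mutable k) (h : Q.arr k j = 0) {s : V → ℚ} (hsj : s j = 3)
    (hs : ∀ v, v ≠ j → s v = 1 ∨ s v = -1) (hP : Specializes s (Q.exchange ambientX j) 0)
    (hPk : Q.arr j k = 0 → ∃ w, w ≠ 0 ∧ Specializes s (Q.exchange ambientX k) w) :
    LaurentNonvanishing s ((Q.seedAt [j, k]).cluster k) ∧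
      LaurentNonvanishing s ((Q.seedAt [j, k, j]).cluster j) := by
  classical
  have hC : (∏ i, ambientX i ^ (if i = j then 0 else (Q.mutate j).arr k i)) ∈ signUnits s :=
    monomial_mem_signUnits fun v hv => hs v (by rintro rfl; simp at hv)
  have hD : (∏ i, ambientX i ^ (Q.mutate j).arr i k) ∈ signUnits s :=
    monomial_mem_signUnits fun v hv => hs v (by
      rintro rfl; rw [mutate_arr_self_left, h] at hv; simp at hv)
  have hE : (∏ i, ambientX i ^ (if i = k then 0 else ((Q.mutate j).mutate k).arr j i)) ∈
      signUnits s :=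
    monomial_mem_signUnits fun v hv => hs v (by rintro rfl; simp [IceQuiver.no_loop] at hv)
  have hin : (∏ i, ambientX i ^ Q.arr i j) ∈ signUnits s :=
    monomial_mem_signUnits fun v hv => hs v (by rintro rfl; simp [IceQuiver.no_loop] at hv)
  have hXk : ambientX k ∈ signUnits s := ambientX_mem_signUnits (hs k hjk.symm)
  have hXj := Specializes.ambientX (s := s) j
  rw [hsj] at hXj
  have hx : Specializes s (Q.exchange ambientX j / ambientX j) 0 := by
    simpa using hP.div hXj (by norm_num)
  have hxm : Q.exchange ambientX j / ambientX j ∈ ambientLaurent V := by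
    rw [div_eq_mul_inv]
    exact mul_mem (exchange_ambientX_mem Q j) (inv_mem_laurentRing j)
  have hx0 : Q.exchange ambientX j / ambientX j ≠ 0 :=
    div_ne_zero (exchange_ambientX_ne_zero Q j) (ambientX_ne_zero j)
  have hα := div_mem_signUnits hD hXk
  have hU := div_mem_signUnits (mul_mem hE (pow_mem hα (Q.arr j k))) hin
  have h2 := Q.seedAt_pair_cluster hjk h
  have h3 := Q.seedAt_triple_cluster hjk hj h
  have hγ := div_mem_signUnits hC hXk
  obtain ⟨u, hu, hu'⟩ := exists_value_of_mem_signUnits hU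
  have hu' := hu'.mul hXj
  have hUm := mul_mem hU.1 (mem_laurentRing (a := ambientX) j)
  rcases Nat.eq_zero_or_pos (Q.arr j k) with hb | hb
  · constructor
    · obtain ⟨w, hw, hw'⟩ := hPk hb
      rw [seedAt_pair_cluster_of_not_adj Q hk hjk.symm hb h]
      refine ⟨?_, ?_⟩
      · rw [div_eq_mul_inv]
        exact mul_mem (exchange_ambientX_mem Q k) (inv_mem_laurentRing k)
      · rcases hXk.2.2 with hu | hu
        · exact ⟨w / 1, by simpa using hw, hw'.div hu one_ne_zero⟩
        · exact ⟨w / -1, by simpa using hw, hw'.div hu (by norm_num)⟩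
    · rw [h3, hb]
      rw [hb] at hu' hUm
      rw [pow_zero, pow_zero, sub_self, zero_div, mul_zero, add_zero] at *
      exact ⟨hUm, u * 3, by rcases hu with rfl | rfl <;> norm_num, hu'⟩
  · obtain ⟨b, hb⟩ := Nat.exists_eq_succ_of_ne_zero hb.ne'
    have hy : (Q.seedAt [j, k]).cluster k =
        (Q.exchange ambientX j / ambientX j) ^ Q.arr j k *
          ((∏ i, ambientX i ^ (if i = j then 0 else (Q.mutate j).arr k i)) / ambientX k) +
        (∏ i, ambientX i ^ (Q.mutate j).arr i k) / ambientX k := by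
      rw [h2]; ring
    generalize (∏ i, ambientX i ^ (if i = j then 0 else (Q.mutate j).arr k i)) /
      (ambientX k : AmbientField V) = γ at *
    generalize (∏ i, ambientX i ^ (Q.mutate j).arr i k) /
      (ambientX k : AmbientField V) = α at *
    generalize (∏ i, (ambientX i : AmbientField V) ^
      (if i = k then 0 else ((Q.mutate j).mutate k).arr j i)) = E at *
    generalize (Q.seedAt [j, k]).cluster k = y at *
    generalize Q.exchange ambientX j / ambientX j = x at *
    rw [hb] at *
    have hym : y ∈ ambientLaurent V := by
      rw [hy]; exact add_mem (mul_mem (pow_mem hxm _) hγ.1) hα.1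
    obtain ⟨g, -, hg⟩ := exists_value_of_mem_signUnits hγ
    obtain ⟨e, he, he'⟩ := exists_value_of_mem_signUnits (mul_mem hE hγ)
    obtain ⟨a, ha, ha'⟩ := exists_value_of_mem_signUnits hα
    have hys : Specializes s y a := by
      rw [hy]
      simpa using ((hx.pow (b + 1)).mul hg).add ha'
    -- `y ^ (b + 1) - α ^ (b + 1)` is divisible by `y - α`, which is divisible by `x`.
    have hgeom : (y ^ (b + 1) - α ^ (b + 1)) / x =
        (∑ i ∈ Finset.range (b + 1), y ^ i * α ^ (b + 1 - 1 - i)) * (x ^ b * γ) := by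
      have hd : y - α = x ^ b * γ * x := by rw [hy, Nat.succ_eq_add_one]; ring
      rw [← (Commute.all y α).geom_sum₂_mul, hd]
      field_simp
    refine ⟨⟨hym, a, by rcases ha with rfl | rfl <;> norm_num, hys⟩, ?_⟩
    rw [h3, Nat.succ_eq_add_one, hgeom]
    refine ⟨add_mem hUm (mul_mem hE.1 (mul_mem (sum_mem fun i _ =>
      mul_mem (pow_mem hym _) (pow_mem hα.1 _)) (mul_mem (pow_mem hxm _) hγ.1))), ?_⟩
    rcases Nat.eq_zero_or_pos b with rfl | hb0
    · refine ⟨u * 3 + e, ?_, ?_⟩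
      · rcases hu with rfl | rfl <;> rcases he with rfl | rfl <;> norm_num
      · have := hu'.add he'
        simpa using this
    · refine ⟨u * 3, by rcases hu with rfl | rfl <;> norm_num, ?_⟩
      obtain ⟨t, ht⟩ : ∃ t, Specializes s
          (∑ i ∈ Finset.range (b + 1), y ^ i * α ^ (b + 1 - 1 - i)) t := by
        have hyR : y ∈ specializingTo s ⊤ := ⟨a, trivial, hys⟩
        have hαR : α ∈ specializingTo s ⊤ := ⟨a, trivial, ha'⟩
        have : (∑ i ∈ Finset.range (b + 1), y ^ i * α ^ (b + 1 - 1 - i)) ∈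
            specializingTo s ⊤ :=
          sum_mem fun i _ => mul_mem (pow_mem hyR _) (pow_mem hαR _)
        obtain ⟨t, -, ht⟩ := this
        exact ⟨t, ht⟩
      obtain ⟨e₁, -, he₁⟩ := exists_value_of_mem_signUnits hE
      have := hu'.add (he₁.mul (ht.mul ((hx.pow b).mul hg)))
      simpa [hb0.ne'] using this

end IceQuiver

namespace IceQuiver

variable {V : Type*}

/-- The quiver with all arrows reversed. -/
def opposite (Q : IceQuiver V) : IceQuiver V where
  Mutable := Q.Mutable
  arr i j := Q.arr j i
  no_loop := Q.no_loop
  no_two_cycle i j := Q.no_two_cycle j i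
  no_frozen_arrow i j hi hj := Q.no_frozen_arrow j i hj hi

theorem opposite_mutate (Q : IceQuiver V) (k : V) :
    Q.opposite.mutate k = (Q.mutate k).opposite := by
  ext i j
  · rfl
  · by_cases hi : i = k
    · subst hi
      simp [opposite, mutate_arr_self_left, mutate_arr_self_right]
    by_cases hj : j = k
    · subst hj
      simp [opposite, mutate_arr_self_left, mutate_arr_self_right]
    by_cases h : Q.Mutable i ∨ Q.Mutable j
    · rw [mutate_arr Q.opposite hi hj h]
      simp only [opposite]
      rw [mutate_arr _ hj hi h.symm, mul_comm (Q.arr k i), mul_comm (Q.arr k j)]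
    · push Not at h
      exact ((Q.opposite.mutate k).no_frozen_arrow i j h.1 h.2).trans
        ((Q.mutate k).opposite.no_frozen_arrow i j h.1 h.2).symm

/-- Substituting `c` for `x_y` in a Laurent polynomial changes it by a multiple of `x_y - c`. -/
theorem exists_specializes_sub_eq_mul [DecidableEq V] {y : V} {c : AmbientField V} (hc0 : c ≠ 0)
    (hc : c ∈ ambientLaurent V) (hc' : c⁻¹ ∈ ambientLaurent V) {u : AmbientField V}
    (hu : u ∈ ambientLaurent V) :
    ∃ w ∈ ambientLaurent V, Specializes (Function.update ambientX y c) u w ∧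
      ∃ h ∈ ambientLaurent V, u - w = (ambientX y - c) * h := by
  have hX := fun v => Specializes.ambientX (s := Function.update ambientX y c) v
  induction hu using Subring.closure_induction with
  | mem u hu =>
    rcases hu with ⟨v, rfl⟩ | ⟨v, rfl⟩
    · have hv := hX v
      by_cases h : v = y
      · subst h
        rw [Function.update_self] at hv
        exact ⟨c, hc, hv, 1, one_mem _, by ring⟩
      · rw [Function.update_of_ne h] at hv
        exact ⟨_, mem_laurentRing v, hv, 0, zero_mem _, by ring⟩
    · have hv := hX v
      by_cases h : v = y
      · subst h
        rw [Function.update_self] at hv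
        refine ⟨_, hc', hv.inv hc0, -((ambientX v)⁻¹ * c⁻¹),
          neg_mem (mul_mem (inv_mem_laurentRing v) hc'), ?_⟩
        have := ambientX_ne_zero v
        field_simp
        ring
      · rw [Function.update_of_ne h] at hv
        exact ⟨_, inv_mem_laurentRing v, hv.inv (ambientX_ne_zero v), 0, zero_mem _, by ring⟩
  | zero => exact ⟨0, zero_mem _, .zero, 0, zero_mem _, by ring⟩
  | one => exact ⟨1, one_mem _, .one, 0, zero_mem _, by ring⟩
  | add u u' _ _ hu hu' =>
    obtain ⟨w, hw, hs, h, hh, e⟩ := hu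
    obtain ⟨w', hw', hs', h', hh', e'⟩ := hu'
    exact ⟨_, add_mem hw hw', hs.add hs', _, add_mem hh hh', by linear_combination e + e'⟩
  | neg u _ hu =>
    obtain ⟨w, hw, hs, h, hh, e⟩ := hu
    exact ⟨_, neg_mem hw, hs.neg, _, neg_mem hh, by linear_combination -e⟩
  | mul u u' hum _ hu hu' =>
    obtain ⟨w, hw, hs, h, hh, e⟩ := hu
    obtain ⟨w', hw', hs', h', hh', e'⟩ := hu'
    exact ⟨_, mul_mem hw hw', hs.mul hs', _, add_mem (mul_mem hum hh') (mul_mem hw' hh),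
      by linear_combination u * e' + w' * e⟩

variable [Fintype V]

theorem opposite_exchange (Q : IceQuiver V) {R : Type*} [CommSemiring R] (a : V → R) (k : V) :
    Q.opposite.exchange a k = Q.exchange a k :=
  add_comm _ _

theorem opposite_seedAt (Q : IceQuiver V) (l : List V) :
    (Q.opposite.seedAt l).cluster = (Q.seedAt l).cluster ∧
      (Q.opposite.seedAt l).quiver = (Q.seedAt l).quiver.opposite := by
  induction l using List.reverseRecOn with
  | nil => exact ⟨rfl, rfl⟩
  | append_singleton l k ih =>
    rw [seedAt_concat, seedAt_concat]
    refine ⟨funext fun v => ?_, ?_⟩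
    · by_cases hv : v = k
      · subst hv
        rw [ClusterSeed.mutate_cluster_self, ClusterSeed.mutate_cluster_self, ih.1, ih.2,
          opposite_exchange]
      · rw [ClusterSeed.mutate_cluster_of_ne _ hv, ClusterSeed.mutate_cluster_of_ne _ hv, ih.1]
    · change (Q.opposite.seedAt l).quiver.mutate k = ((Q.seedAt l).quiver.mutate k).opposite
      rw [ih.2, opposite_mutate]

theorem laurentNonvanishing_seedAt (Q : IceQuiver V) {j k : V} (hjk : j ≠ k)
    (hj : Q.Mutable j) (hk : Q.Mutable k) {s : V → ℚ} (hsj : s j = 3)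
    (hs : ∀ v, v ≠ j → s v = 1 ∨ s v = -1) (hP : Specializes s (Q.exchange ambientX j) 0)
    (hPk : Q.arr j k = 0 → Q.arr k j = 0 → ∃ w, w ≠ 0 ∧ Specializes s (Q.exchange ambientX k) w) :
    LaurentNonvanishing s ((Q.seedAt [j, k]).cluster k) ∧
      LaurentNonvanishing s ((Q.seedAt [j, k, j]).cluster j) := by
  rcases Q.no_two_cycle k j with h | h
  · exact Q.laurentNonvanishing_of_arr_eq_zero hjk hj hk h hsj hs hP fun h' => hPk h' h
  · have := Q.opposite.laurentNonvanishing_of_arr_eq_zero hjk hj hk h hsj hs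
      (by rwa [opposite_exchange]) fun h' => by rw [opposite_exchange]; exact hPk h h'
    rwa [(Q.opposite_seedAt _).1, (Q.opposite_seedAt _).1] at this

/-- If the frozen vertex `y` is adjacent only to `j`, then the exchange polynomial of `j` is linear
in `x_y`, hence prime, and it divides neither of the two variables created by the last two of the
mutations at `j`, `k`, `j`. So no power of it is the denominator of an element that is a Laurent
polynomial in both of the clusters obtained by the mutations at `j` and at `j`, `k`, `j`. -/
theorem mem_ambientLaurent_of_framed (Q : IceQuiver V) {j k y : V} (hjk : j ≠ k)
    (hj : Q.Mutable j) (hk : Q.Mutable k) (hy : ¬ Q.Mutable y) (hyj : Q.arr y j = 1)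
    (hyv : ∀ v, v ≠ j → Q.arr y v = 0 ∧ Q.arr v y = 0) {z : AmbientField V}
    (h1 : z ∈ laurentRing (Q.seedAt [j]).cluster)
    (h3 : z ∈ laurentRing (Q.seedAt [j, k, j]).cluster) : z ∈ ambientLaurent V := by
  classical
  have hjy : j ≠ y := by rintro rfl; exact hy hj
  have hjy0 : Q.arr j y = 0 := by have := Q.no_two_cycle j y; omega
  -- The numerical test point, a zero of the exchange polynomial of `j`. The value `3` of `x_j` is
  -- chosen such that the sum of `± x_j` and a sign does not vanish.
  set s : V → ℚ := fun v => if v = y then -1 else if v = j then 3 else 1 with hs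
  have hone : ∀ e : V → ℕ, e y = 0 → e j = 0 → ∏ i, s i ^ e i = 1 := by
    intro e he he'
    refine Finset.prod_eq_one fun i _ => ?_
    by_cases hi : i = y
    · rw [hi, he, pow_zero]
    by_cases hi' : i = j
    · rw [hi', he', pow_zero]
    simp [hs, hi, hi']
  have hXs := fun v => Specializes.ambientX (s := s) v
  have hLs : ambientLaurent V ≤ specializingTo s ⊤ := by
    refine laurentRing_le (fun v => ⟨_, trivial, hXs v⟩) fun v =>
      ⟨_, trivial, (hXs v).inv ?_⟩
    simp only [hs]; split_ifs <;> norm_num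
  have hP : Specializes s (Q.exchange ambientX j) 0 := by
    have hval : Q.exchange s j = 0 := by
      rw [exchange, hone _ hjy0 (Q.no_loop j),
        prod_pow_eq_of_eq_off (k := y) (fun v _ => rfl) (fun i => Q.arr i j),
        hone _ (if_pos rfl) (by simp [Q.no_loop]), hyj, show s y = -1 from if_pos rfl]
      norm_num
    rw [← hval]
    exact Specializes.exchange Q hXs j
  have hPk : Q.arr j k = 0 → Q.arr k j = 0 →
      ∃ w, w ≠ 0 ∧ Specializes s (Q.exchange ambientX k) w := by
    intro h h'
    have hval : Q.exchange s k = 2 := by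
      rw [exchange, hone _ (hyv k hjk.symm).2 h', hone _ (hyv k hjk.symm).1 h]
      norm_num
    refine ⟨2, two_ne_zero, ?_⟩
    rw [← hval]
    exact Specializes.exchange Q hXs k
  obtain ⟨⟨hMk, wk, hwk, hMks⟩, ⟨hMj, wj, hwj, hMjs⟩⟩ :=
    Q.laurentNonvanishing_seedAt hjk hj hk (s := s) (by simp [hs, hjy])
      (fun v hv => by by_cases h : v = y <;> simp [hs, h, hv]) hP hPk
  -- The exchange polynomial of `j` is `A * (x_y - c)`.
  have hA := monomial_mem_signUnits (s := fun _ : V => (1 : ℚ))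
    (e := fun i => if i = y then 0 else Q.arr i j) fun _ _ => Or.inl rfl
  have hB := monomial_mem_signUnits (s := fun _ : V => (1 : ℚ))
    (e := fun i => Q.arr j i) fun _ _ => Or.inl rfl
  have hPd : Q.exchange ambientX j = (∏ i, (ambientX i : AmbientField V) ^ Q.arr j i) +
      ambientX y * ∏ i, ambientX i ^ (if i = y then 0 else Q.arr i j) := by
    rw [exchange, prod_pow_eq_of_eq_off (k := y) (fun v _ => rfl) (fun i => Q.arr i j), hyj,
      pow_one]
  have hX0 : ∀ e : V → ℕ, ∏ i, (ambientX i : AmbientField V) ^ e i ≠ 0 := fun e =>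
    Finset.prod_ne_zero_iff.2 fun i _ => pow_ne_zero _ (ambientX_ne_zero i)
  have hself : ∀ (c : AmbientField V) (e : V → ℕ), e y = 0 →
      Specializes (Function.update ambientX y c)
        (∏ i, (ambientX i : AmbientField V) ^ e i) (∏ i, ambientX i ^ e i) := by
    intro c e he
    refine Specializes.prod _ fun i _ => ?_
    by_cases hi : i = y
    · rw [hi, he, pow_zero]; exact .one
    · have := Specializes.ambientX (s := Function.update ambientX y c) i
      rw [Function.update_of_ne hi] at this
      exact this.pow _
  have hA0 := hX0 fun i => if i = y then 0 else Q.arr i j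
  have hB0 := hX0 fun i => Q.arr j i
  have hAself := fun c => hself c (fun i => if i = y then 0 else Q.arr i j) (if_pos rfl)
  have hBself := fun c => hself c (fun i => Q.arr j i) hjy0
  generalize (∏ i, (ambientX i : AmbientField V) ^ (if i = y then 0 else Q.arr i j)) = A at *
  generalize (∏ i, (ambientX i : AmbientField V) ^ Q.arr j i) = B at *
  obtain ⟨c, hc⟩ : ∃ c, c = -(B / A) := ⟨_, rfl⟩
  have hPc : Q.exchange ambientX j = A * (ambientX y - c) := by
    rw [hPd, hc]; field_simp; ring
  have hcm : c ∈ ambientLaurent V := by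
    rw [hc, div_eq_mul_inv]; exact neg_mem (mul_mem hB.1 hA.2.1)
  have hcm' : c⁻¹ ∈ ambientLaurent V := by
    rw [hc, inv_neg, inv_div, div_eq_mul_inv]; exact neg_mem (mul_mem hA.1 hB.2.1)
  have hc0 : c ≠ 0 := by rw [hc]; exact neg_ne_zero.2 (div_ne_zero hB0 hA0)
  have hcself : Specializes (Function.update ambientX y c) c c := by
    have := ((hBself c).div (hAself c) hA0).neg
    rwa [← hc] at this
  have hpm : ambientX y - c ∈ ambientLaurent V := sub_mem (mem_laurentRing y) hcm
  have hpself : Specializes (Function.update ambientX y c) (ambientX y - c) 0 := by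
    have := (Specializes.ambientX (s := Function.update ambientX y c) y).sub hcself
    rwa [Function.update_self, sub_self] at this
  have hps : Specializes s (ambientX y - c) 0 := by
    have e : ambientX y - c = Q.exchange ambientX j * A⁻¹ := by rw [hPc]; field_simp
    obtain ⟨w, -, hw⟩ : A⁻¹ ∈ specializingTo s ⊤ := hLs hA.2.1
    rw [e]
    simpa using hP.mul hw
  have hp0 : ambientX y - c ≠ 0 := by
    intro h
    apply exchange_ambientX_ne_zero Q j
    rw [hPc, h, mul_zero]
  -- `z` has powers of `x_y - c` and of `M` as denominators.
  obtain ⟨M, hM⟩ : ∃ M, M = (Q.seedAt [j, k]).cluster k * (Q.seedAt [j, k, j]).cluster j :=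
    ⟨_, rfl⟩
  have hMm : M ∈ ambientLaurent V := by rw [hM]; exact mul_mem hMk hMj
  have hMs : Specializes s M (wk * wj) := by rw [hM]; exact hMks.mul hMjs
  obtain ⟨n, hn⟩ : z ∈ awayRing (ambientLaurent V) (ambientX y - c) hpm := by
    refine laurentRing_le (fun v => ?_) (fun v => ?_) h1
    · exact le_awayRing hpm (Q.seedAt_singleton_cluster_mem j v)
    · by_cases hv : v = j
      · subst hv
        refine ⟨1, ?_⟩
        have e : (ambientX y - c) ^ 1 * ((Q.seedAt [v]).cluster v)⁻¹ = ambientX v * A⁻¹ := by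
          rw [seedAt_singleton_cluster_self, hPc]; field_simp
        rw [e]
        exact mul_mem (mem_laurentRing v) hA.2.1
      · rw [seedAt_singleton_cluster_of_ne Q hv]
        exact le_awayRing hpm (inv_mem_laurentRing v)
  obtain ⟨b, hb⟩ : z ∈ awayRing (ambientLaurent V) M hMm := by
    have hc3 : ∀ v, v ≠ j → (Q.seedAt [j, k, j]).cluster v = (Q.seedAt [j, k]).cluster v :=
      fun v hv => ClusterSeed.mutate_cluster_of_ne _ hv
    have hc2 : ∀ v, v ≠ k → (Q.seedAt [j, k]).cluster v = (Q.seedAt [j]).cluster v :=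
      fun v hv => ClusterSeed.mutate_cluster_of_ne _ hv
    have hk0 := Q.seedAt_cluster_ne_zero [j, k] k
    have hj0 := Q.seedAt_cluster_ne_zero [j, k, j] j
    refine laurentRing_le (fun v => ?_) (fun v => ?_) h3
    · refine le_awayRing hMm ?_
      by_cases hvj : v = j
      · rwa [hvj]
      rw [hc3 v hvj]
      by_cases hvk : v = k
      · rwa [hvk]
      rw [hc2 v hvk]
      exact Q.seedAt_singleton_cluster_mem j v
    · by_cases hvj : v = j
      · rw [hvj]
        refine ⟨1, ?_⟩
        have e : M ^ 1 * ((Q.seedAt [j, k, j]).cluster j)⁻¹ = (Q.seedAt [j, k]).cluster k := by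
          rw [hM]; field_simp
        rwa [e]
      rw [hc3 v hvj]
      by_cases hvk : v = k
      · rw [hvk]
        refine ⟨1, ?_⟩
        have e : M ^ 1 * ((Q.seedAt [j, k]).cluster k)⁻¹ = (Q.seedAt [j, k, j]).cluster j := by
          rw [hM]; field_simp
        rwa [e]
      rw [hc2 v hvk, seedAt_singleton_cluster_of_ne Q hvj]
      exact le_awayRing hMm (inv_mem_laurentRing v)
  obtain ⟨m, -, hm, g, hg, hmg⟩ := exists_specializes_sub_eq_mul (y := y) hc0 hcm hcm' hMm
  have hm0 : m ≠ 0 := by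
    rintro rfl
    rw [sub_zero] at hmg
    obtain ⟨w, -, hw⟩ : g ∈ specializingTo s ⊤ := hLs hg
    have h0 := hps.mul hw
    rw [← hmg, zero_mul] at h0
    exact mul_ne_zero hwk hwj (hMs.unique h0)
  -- The factors `x_y - c` of the first denominator are removed one by one.
  clear h1 h3
  induction n with
  | zero => simpa using hn
  | succ n ih =>
    refine ih ?_
    obtain ⟨w, -, hw, h, hh, e⟩ := exists_specializes_sub_eq_mul (y := y) hc0 hcm hcm' hn
    obtain ⟨t, -, ht, -⟩ := exists_specializes_sub_eq_mul (y := y) hc0 hcm hcm' hb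
    have e1 := (hm.pow b).mul hw
    have e2 := (hpself.pow (n + 1)).mul ht
    rw [show M ^ b * ((ambientX y - c) ^ (n + 1) * z) =
      (ambientX y - c) ^ (n + 1) * (M ^ b * z) by ring] at e1
    have e3 := e1.unique e2
    rw [zero_pow (Nat.succ_ne_zero n), zero_mul] at e3
    have hw0 : w = 0 := (mul_eq_zero.1 e3).resolve_left (pow_ne_zero _ hm0)
    rw [hw0, sub_zero, pow_succ', mul_assoc] at e
    rw [mul_left_cancel₀ hp0 e]
    exact hh

end IceQuiver

namespace IceQuiver

variable {V : Type*}

open Classical in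
/-- The quiver with a new frozen vertex `none` and one arrow from it to the mutable vertex `j`. -/
noncomputable def frame (Q : IceQuiver V) (j : V) (hj : Q.Mutable j) : IceQuiver (Option V) where
  Mutable v := v.elim False Q.Mutable
  arr a b := b.elim 0 fun b' => a.elim (if b' = j then 1 else 0) fun a' => Q.arr a' b'
  no_loop a := by
    cases a
    · rfl
    · exact Q.no_loop _
  no_two_cycle a b := by
    cases a
    · exact Or.inr rfl
    · cases b
      · exact Or.inl rfl
      · exact Q.no_two_cycle _ _
  no_frozen_arrow a b ha hb := by
    cases b with
    | none => rfl
    | some b =>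
      cases a with
      | none =>
        have : b ≠ j := by
          rintro rfl
          exact hb hj
        simp [this]
      | some a => exact Q.no_frozen_arrow a b ha hb

theorem mem_ambientLaurent_of_frame {z : AmbientField (Option V)} {w : AmbientField V}
    (hz : z ∈ ambientLaurent (Option V))
    (h : Specializes (fun a : Option V => a.elim 1 ambientX) z w) : w ∈ ambientLaurent V := by
  have hle : ambientLaurent (Option V) ≤
      specializingTo (fun a : Option V => a.elim 1 ambientX) (ambientLaurent V) := by
    refine laurentRing_le (fun a => ?_) fun a => ?_
    · refine ⟨_, ?_, Specializes.ambientX a⟩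
      cases a
      · exact one_mem _
      · exact mem_laurentRing _
    · cases a with
      | none => exact ⟨_, by simp, (Specializes.ambientX none).inv one_ne_zero⟩
      | some a =>
        exact ⟨_, inv_mem_laurentRing a, (Specializes.ambientX (some a)).inv (ambientX_ne_zero a)⟩
  obtain ⟨w', hw', hs⟩ := hle hz
  rwa [h.unique hs]

variable [Fintype V]

/-- Setting the variable of the additional frozen vertex `none` to `1` turns `S` into `T`. -/
structure SpecializesTo (S : ClusterSeed (Option V)) (T : ClusterSeed V) : Prop where
  mutable_iff : ∀ v, S.quiver.Mutable (some v) ↔ T.quiver.Mutable v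
  arr_eq : ∀ a b, S.quiver.arr (some a) (some b) = T.quiver.arr a b
  cluster_none : S.cluster none = ambientX none
  cluster_some : ∀ v, Specializes (fun a : Option V => a.elim 1 ambientX)
    (S.cluster (some v)) (T.cluster v)

theorem SpecializesTo.mutate {S : ClusterSeed (Option V)} {T : ClusterSeed V}
    (h : SpecializesTo S T) {k : V} (hk : T.cluster k ≠ 0) :
    SpecializesTo (S.mutate (some k)) (T.mutate k) where
  mutable_iff := h.mutable_iff
  arr_eq a b := by
    change (S.quiver.mutate (some k)).arr (some a) (some b) = (T.quiver.mutate k).arr a b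
    by_cases ha : a = k
    · rw [ha, mutate_arr_self_left, mutate_arr_self_left, h.arr_eq]
    by_cases hb : b = k
    · rw [hb, mutate_arr_self_right, mutate_arr_self_right, h.arr_eq]
    by_cases hm : T.quiver.Mutable a ∨ T.quiver.Mutable b
    · rw [mutate_arr _ ha hb hm, mutate_arr _ (by simpa using ha) (by simpa using hb)
        (by simpa only [h.mutable_iff] using hm)]
      simp only [h.arr_eq]
    · push Not at hm
      rw [(T.quiver.mutate k).no_frozen_arrow a b hm.1 hm.2]
      refine (S.quiver.mutate (some k)).no_frozen_arrow _ _ ?_ ?_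
      · exact fun h' => hm.1 ((h.mutable_iff a).1 h')
      · exact fun h' => hm.2 ((h.mutable_iff b).1 h')
  cluster_none := by
    rw [ClusterSeed.mutate_cluster_of_ne _ (by simp), h.cluster_none]
  cluster_some v := by
    by_cases hv : v = k
    · subst hv
      rw [ClusterSeed.mutate_cluster_self, ClusterSeed.mutate_cluster_self]
      refine Specializes.div ?_ (h.cluster_some v) hk
      have hc : ∀ a, Specializes (fun a : Option V => a.elim 1 ambientX) (S.cluster a)
          (a.elim 1 T.cluster) := by
        rintro (_ | a)
        · rw [h.cluster_none]
          exact Specializes.ambientX none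
        · exact h.cluster_some a
      have := Specializes.exchange S.quiver hc (some v)
      have e : S.quiver.exchange (fun a => a.elim 1 T.cluster) (some v) =
          T.quiver.exchange T.cluster v := by
        simp [IceQuiver.exchange, Fintype.prod_option, h.arr_eq]
      rwa [e] at this
    · rw [ClusterSeed.mutate_cluster_of_ne _ (by simpa using hv),
        ClusterSeed.mutate_cluster_of_ne _ hv]
      exact h.cluster_some v

theorem specializesTo_frame (Q : IceQuiver V) (j : V) (hj : Q.Mutable j) (l : List V) :
    SpecializesTo ((Q.frame j hj).seedAt (l.map some)) (Q.seedAt l) := by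
  induction l using List.reverseRecOn with
  | nil =>
    exact ⟨fun v => Iff.rfl, fun a b => rfl, rfl,
      fun v => Specializes.ambientX (s := fun a : Option V => a.elim 1 ambientX) (some v)⟩
  | append_singleton l k ih =>
    rw [List.map_append, List.map_singleton, seedAt_concat, seedAt_concat]
    exact ih.mutate (Q.seedAt_cluster_ne_zero l k)

/-- The Laurent phenomenon: all cluster variables are Laurent polynomials in the initial ones. For
the induction on the number of mutations, an additional frozen vertex is attached to the first
vertex that is mutated. -/
theorem seedAt_cluster_mem_ambientLaurent.{u} (n : ℕ) : ∀ {V : Type u} [Fintype V]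
    (Q : IceQuiver V) (l : List V), l.length = n → (∀ k ∈ l, Q.Mutable k) →
    ∀ v, (Q.seedAt l).cluster v ∈ ambientLaurent V := by
  induction n using Nat.strong_induction_on with
  | _ n ih =>
    intro V _ Q l hl hmut v
    have step : ∀ {W : Type u} [Fintype W] (R : IceQuiver W) (l l' : List W), l'.length < n →
        (∀ k ∈ l', R.Mutable k) →
        ∀ v, (R.seedAt (l ++ l')).cluster v ∈ laurentRing (R.seedAt l).cluster := by
      intro W _ R l l' hl' hmut' v
      obtain ⟨φ, hφ⟩ := R.exists_hom_seedAt l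
      rw [R.seedAt_append l l' hφ]
      refine map_mem_laurentRing φ hφ (ih _ hl' _ l' rfl ?_ v)
      rwa [mutable_seedAt]
    match l, hl, hmut with
    | [], _, _ => exact mem_laurentRing v
    | [j], _, _ => exact Q.seedAt_singleton_cluster_mem j v
    | j :: k :: l, hl, hmut =>
      simp only [List.length_cons] at hl
      by_cases hjk : j = k
      · subst hjk
        rw [show j :: j :: l = [] ++ j :: j :: l from rfl, seedAt_append_pair]
        exact ih _ (by simp only [List.nil_append]; omega) Q _ rfl
          (fun i hi => hmut i (by simp at hi; simp [hi])) v
      have hj : Q.Mutable j := hmut j (by simp)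
      have hk : Q.Mutable k := hmut k (by simp)
      have hmut' : ∀ i ∈ l.map some, (Q.frame j hj).Mutable i := by
        intro i hi
        obtain ⟨i, hi', rfl⟩ := List.mem_map.1 hi
        exact hmut i (List.mem_cons_of_mem _ (List.mem_cons_of_mem _ hi'))
      refine mem_ambientLaurent_of_frame ?_
        ((Q.specializesTo_frame j hj (j :: k :: l)).cluster_some v)
      refine mem_ambientLaurent_of_framed (Q.frame j hj) (j := some j) (k := some k) (y := none)
        (by simpa using hjk) hj hk id (if_pos rfl) (fun v hv => ⟨?_, rfl⟩) ?_ ?_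
      · cases v with
        | none => rfl
        | some v => exact if_neg (by simpa using hv)
      · refine step (Q.frame j hj) [some j] (some k :: l.map some) ?_ ?_ (some v)
        · simp only [List.length_cons, List.length_map]; omega
        · simp only [List.mem_cons]
          rintro i (rfl | hi)
          · exact hk
          · exact hmut' i hi
      · have := step (Q.frame j hj) [some j, some k, some j] (some j :: l.map some) ?_ ?_ (some v)
        · rw [show [some j, some k, some j] ++ some j :: l.map some =
            [some j, some k] ++ some j :: some j :: l.map some from rfl, seedAt_append_pair] at this
          exact this
        · simp only [List.length_cons, List.length_map]; omega
        · simp only [List.mem_cons]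
          rintro i (rfl | hi)
          · exact hj
          · exact hmut' i hi

/-- Every cluster variable is a Laurent polynomial in every cluster. -/
theorem seedAt_cluster_mem_laurentRing (Q : IceQuiver V) {l l' : List V}
    (hl : ∀ k ∈ l, Q.Mutable k) (hl' : ∀ k ∈ l', Q.Mutable k) (v : V) :
    (Q.seedAt l').cluster v ∈ laurentRing (Q.seedAt l).cluster := by
  obtain ⟨φ, hφ⟩ := Q.exists_hom_seedAt l
  rw [← Q.seedAt_append_reverse l l', Q.seedAt_append l _ hφ]
  refine map_mem_laurentRing φ hφ (seedAt_cluster_mem_ambientLaurent _ _ _ rfl ?_ v)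
  rw [mutable_seedAt]
  simp only [List.mem_append, List.mem_reverse]
  rintro k (hk | hk)
  · exact hl k hk
  · exact hl' k hk

end IceQuiver

/-! ### Charts at sets of pairwise non-adjacent mutable vertices -/

section Subring

variable {K : Type*} [Field K]

theorem eval₂_mem_of_le {C R : Subring K} (hC : C ≤ R) {x : K} (hx : x ∈ R) (f : Polynomial C) :
    f.eval₂ C.subtype x ∈ R := by
  rw [Polynomial.eval₂_eq_sum_range]
  exact sum_mem fun i _ => mul_mem (hC (f.coeff i).2) (pow_mem hx i)

/-- Up to a polynomial `h` in `x' = p / x`, the quotient `g(x') / x'ⁿ` is a polynomial in `x`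
divided by a power of `p`, because `1 / x' = x / p`. -/
theorem exists_principal_part (C : Subring K) {x p : K} (hx : x ≠ 0) (hp0 : p ≠ 0) (hp : p ∈ C)
    (n : ℕ) (g : Polynomial C) :
    ∃ h f : Polynomial C, p ^ n * (g.eval₂ C.subtype (p / x) / (p / x) ^ n -
      h.eval₂ C.subtype (p / x)) = f.eval₂ C.subtype x := by
  induction n generalizing g with
  | zero => exact ⟨g, 0, by simp⟩
  | succ n ih =>
    obtain ⟨h, f, e⟩ := ih g.divX
    refine ⟨h, Polynomial.C (⟨p, hp⟩ : C) * f +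
      Polynomial.C (g.coeff 0) * Polynomial.X ^ (n + 1), ?_⟩
    have hg : g.eval₂ C.subtype (p / x) =
        g.divX.eval₂ C.subtype (p / x) * (p / x) + g.coeff 0 := by
      conv_lhs => rw [← g.divX_mul_X_add]
      simp
    have e' : (Polynomial.C (⟨p, hp⟩ : C) * f + Polynomial.C (g.coeff 0) *
        Polynomial.X ^ (n + 1)).eval₂ C.subtype x =
        p * f.eval₂ C.subtype x + g.coeff 0 * x ^ (n + 1) := by
      simp
    rw [e', hg, ← e]
    generalize g.divX.eval₂ C.subtype (p / x) = a
    generalize h.eval₂ C.subtype (p / x) = b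
    obtain ⟨t, ht⟩ : ∃ t, t = p / x := ⟨_, rfl⟩
    have ht0 : t ≠ 0 := by rw [ht]; exact div_ne_zero hp0 hx
    have hpt : p = t * x := by rw [ht]; field_simp
    rw [← ht, hpt]
    field_simp
    ring

/-- If `x` is transcendental over `C` and `p ∈ C` is not zero, then the intersection of
`C[x, x⁻¹]` and `C[p / x, x / p]` is `C[x, p / x]`. -/
theorem mem_closure_of_mem_of_mem (C : Subring K) {x p : K} (hx : x ≠ 0) (hp0 : p ≠ 0) (hp : p ∈ C)
    (hinj : Function.Injective (Polynomial.eval₂RingHom C.subtype x)) {z : K}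
    (h₁ : z ∈ Subring.closure ((C : Set K) ∪ {x, x⁻¹}))
    (h₂ : z ∈ Subring.closure ((C : Set K) ∪ {p / x, (p / x)⁻¹})) :
    z ∈ Subring.closure ((C : Set K) ∪ {x, p / x}) := by
  have away : ∀ {y w : K}, y ≠ 0 → w ∈ Subring.closure ((C : Set K) ∪ {y, y⁻¹}) →
      ∃ (n : ℕ) (f : Polynomial C), y ^ n * w = f.eval₂ C.subtype y := by
    intro y w hy hw
    have hym : y ∈ (Polynomial.eval₂RingHom C.subtype y).range := ⟨Polynomial.X, by simp⟩
    have : Subring.closure ((C : Set K) ∪ {y, y⁻¹}) ≤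
        awayRing (Polynomial.eval₂RingHom C.subtype y).range y hym := by
      refine Subring.closure_le.2 ?_
      rintro a (ha | rfl | rfl)
      · exact le_awayRing hym ⟨Polynomial.C (⟨a, ha⟩ : C), by simp⟩
      · exact le_awayRing hym hym
      · exact ⟨1, 1, by simp [hy]⟩
    obtain ⟨n, f, e⟩ := this hw
    exact ⟨n, f, e.symm⟩
  have hpx : p / x ≠ 0 := div_ne_zero hp0 hx
  obtain ⟨n, g, hg⟩ := away hpx h₂
  obtain ⟨h, f, e⟩ := exists_principal_part C hx hp0 hp n g
  have hz : g.eval₂ C.subtype (p / x) / (p / x) ^ n = z := by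
    rw [← hg, mul_div_cancel_left₀ _ (pow_ne_zero n hpx)]
  rw [hz] at e
  have hCle : ∀ S : Set K, C ≤ Subring.closure ((C : Set K) ∪ S) := fun S a ha =>
    Subring.subset_closure (Or.inl ha)
  have hw : z - h.eval₂ C.subtype (p / x) ∈ Subring.closure ((C : Set K) ∪ {x, x⁻¹}) := by
    refine sub_mem h₁ (eval₂_mem_of_le (hCle _) ?_ h)
    rw [div_eq_mul_inv]
    exact mul_mem (hCle _ hp) (Subring.subset_closure (Or.inr (Or.inr rfl)))
  obtain ⟨m, q, hq⟩ := away hx hw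
  generalize hwd : z - h.eval₂ C.subtype (p / x) = w at *
  have hpoly : Polynomial.C ((⟨p, hp⟩ : C) ^ n) * q = Polynomial.X ^ m * f := by
    apply hinj
    simp only [Polynomial.coe_eval₂RingHom, Polynomial.eval₂_mul, Polynomial.eval₂_C,
      Polynomial.eval₂_pow, Polynomial.eval₂_X, ← hq, ← e, map_pow, Subring.subtype_apply]
    ring
  have hdvd : Polynomial.X ^ m ∣ q := by
    rw [Polynomial.X_pow_dvd_iff]
    intro d hd
    have h0 : (Polynomial.C ((⟨p, hp⟩ : C) ^ n) * q).coeff d = 0 := by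
      rw [hpoly]
      exact Polynomial.X_pow_dvd_iff.1 ⟨f, rfl⟩ d hd
    rw [Polynomial.coeff_C_mul] at h0
    refine (mul_eq_zero.1 h0).resolve_left (pow_ne_zero _ ?_)
    intro h'
    exact hp0 (congrArg Subtype.val h')
  obtain ⟨r, rfl⟩ := hdvd
  have hwr : w = r.eval₂ C.subtype x := by
    apply mul_left_cancel₀ (pow_ne_zero m hx)
    rw [hq]
    simp
  have hzw : z = w + h.eval₂ C.subtype (p / x) := by rw [← hwd]; ring
  rw [hzw, hwr]
  exact add_mem (eval₂_mem_of_le (hCle _) (Subring.subset_closure (Or.inr (Or.inl rfl))) r)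
    (eval₂_mem_of_le (hCle _) (Subring.subset_closure (Or.inr (Or.inr rfl))) h)

end Subring

namespace IceQuiver

variable {V : Type*}

/-- The variable `x_k` is transcendental over a ring of functions that do not depend on `x_k`. -/
theorem eval₂_ambientX_injective {C : Subring (AmbientField V)} {k : V}
    (hC : ∀ φ : AmbientField V →+* AmbientField V, (∀ v, v ≠ k → φ (ambientX v) = ambientX v) →
      ∀ c ∈ C, φ c = c) :
    Function.Injective (Polynomial.eval₂RingHom C.subtype (ambientX k)) := by
  classical
  rw [injective_iff_map_eq_zero]
  intro f hf
  have hinj : Function.Injective (Int.cast : ℤ → AmbientField V) := by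
    have := (IsFractionRing.injective (MvPolynomial V ℤ) (AmbientField V)).comp
      (MvPolynomial.C_injective V ℤ)
    convert this using 1
    ext n
    simp
  have hroot : ∀ n : ℤ, (f.map C.subtype).IsRoot ((n : AmbientField V) - ambientX k) := by
    intro n
    have hs : ∀ v, Specializes (Function.update ambientX k ((n : AmbientField V) - ambientX k))
        (Function.update ambientX k ((n : AmbientField V) - ambientX k) v)
        (ambientX v) := by
      intro v
      have hv := Specializes.ambientX
        (s := Function.update ambientX k ((n : AmbientField V) - ambientX k)) v
      by_cases h : v = k
      · subst h
        rw [Function.update_self] at hv ⊢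
        have := (Specializes.intCast n).sub hv
        rw [sub_sub_cancel] at this
        exact this
      · rw [Function.update_of_ne h] at hv ⊢
        exact hv
    obtain ⟨φ, hφ⟩ := exists_hom_of_specializes hs
    have h0 := congrArg φ hf
    rw [map_zero, Polynomial.coe_eval₂RingHom, Polynomial.hom_eval₂, hφ,
      Function.update_self] at h0
    have hcomp : φ.comp C.subtype = C.subtype := by
      ext c
      refine hC φ (fun v hv => ?_) c c.2
      rw [hφ, Function.update_of_ne hv]
    rw [hcomp] at h0
    rw [Polynomial.IsRoot, Polynomial.eval_map]
    exact h0
  have hmap : f.map C.subtype = 0 := by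
    apply Polynomial.eq_zero_of_infinite_isRoot
    refine (Set.infinite_range_of_injective
      (f := fun n : ℤ => (n : AmbientField V) - ambientX k) ?_).mono ?_
    · intro a b hab
      exact hinj (sub_left_injective hab)
    · rintro _ ⟨n, rfl⟩
      exact hroot n
  exact (Polynomial.map_eq_zero_iff C.subtype_injective).1 hmap

/-- `I` consists of mutable vertices, no two of which are adjacent. -/
def IsIndependent (Q : IceQuiver V) (I : Finset V) : Prop :=
  ∀ k ∈ I, Q.Mutable k ∧ ∀ l ∈ I, Q.arr k l = 0

theorem IsIndependent.notMem {Q : IceQuiver V} {I : Finset V} (hI : Q.IsIndependent I) {i k : V}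
    (hk : k ∈ I) (h : Q.arr k i ≠ 0 ∨ Q.arr i k ≠ 0) : i ∉ I := by
  intro hi
  rcases h with h | h
  · exact h ((hI k hk).2 i hi)
  · exact h ((hI i hi).2 k hk)

variable [Fintype V]

/-- The variable `x_k'` that replaces `x_k` in the mutation of the initial seed at `k`. -/
noncomputable def mutatedX (Q : IceQuiver V) (k : V) : AmbientField V :=
  Q.exchange ambientX k / ambientX k

theorem seedAt_of_isIndependent [DecidableEq V] {Q : IceQuiver V} {I : Finset V}
    (hI : Q.IsIndependent I) {l : List V} (hl : l.Nodup) (hlI : ∀ k ∈ l, k ∈ I) :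
    (∀ v, (Q.seedAt l).cluster v = if v ∈ l then Q.mutatedX v else ambientX v) ∧
      ∀ k ∈ I, k ∉ l → ∀ i, (Q.seedAt l).quiver.arr k i = Q.arr k i ∧
        (Q.seedAt l).quiver.arr i k = Q.arr i k := by
  induction l using List.reverseRecOn with
  | nil => exact ⟨fun v => rfl, fun _ _ _ _ => ⟨rfl, rfl⟩⟩
  | append_singleton l j ih =>
    rw [List.nodup_append_comm, List.singleton_append, List.nodup_cons] at hl
    have hlI' : ∀ k ∈ l, k ∈ I := fun k hk => hlI k (by simp [hk])
    have hj : j ∈ I := hlI j (by simp)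
    obtain ⟨ih₁, ih₂⟩ := ih hl.2 hlI'
    rw [seedAt_concat]
    constructor
    · intro v
      by_cases hv : v = j
      · subst hv
        rw [ClusterSeed.mutate_cluster_self, ih₁ v, if_neg hl.1, if_pos (by simp), mutatedX]
        congr 1
        refine exchange_congr (fun i => (ih₂ v hj hl.1 i).1) (fun i => (ih₂ v hj hl.1 i).2)
          fun i hi => ?_
        rw [(ih₂ v hj hl.1 i).1, (ih₂ v hj hl.1 i).2] at hi
        rw [ih₁, if_neg fun h => hI.notMem hj hi (hlI' i h)]
      · rw [ClusterSeed.mutate_cluster_of_ne _ hv, ih₁]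
        simp [hv]
    · intro k hk hkl i
      have hkl' : k ∉ l := fun h => hkl (by simp [h])
      have hkj : k ≠ j := by
        rintro rfl
        exact hkl (by simp)
      have hm : (Q.seedAt l).quiver.Mutable k := by
        rw [mutable_seedAt]
        exact (hI k hk).1
      have := (Q.seedAt l).quiver.mutate_arr_of_not_adj hm hkj
        (by rw [(ih₂ k hk hkl' j).2]; exact (hI j hj).2 k hk)
        (by rw [(ih₂ k hk hkl' j).1]; exact (hI k hk).2 j hj) i
      exact ⟨this.1.trans (ih₂ k hk hkl' i).1, this.2.trans (ih₂ k hk hkl' i).2⟩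

open Classical in
/-- The generators at the vertex `v` of the mixed chart of `S` and `J`. -/
noncomputable def chartGens (Q : IceQuiver V) (S J : Finset V) (v : V) : Set (AmbientField V) :=
  if v ∈ S then {ambientX v, Q.mutatedX v}
  else if v ∈ J then {Q.mutatedX v, (Q.mutatedX v)⁻¹}
  else {ambientX v, (ambientX v)⁻¹}

/-- The ring generated by both `x_v` and `x_v'` for `v ∈ S`, by `x_v'` and its inverse for `v ∈ J`,
and by `x_v` and its inverse for the other vertices. -/
noncomputable def chart (Q : IceQuiver V) (S J : Finset V) : Subring (AmbientField V) :=
  Subring.closure (⋃ v, Q.chartGens S J v)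

theorem chart_insert [DecidableEq V] {Q : IceQuiver V} {I : Finset V} (hI : Q.IsIndependent I)
    {S J : Finset V} (hS : S ⊆ I) (hJ : J ⊆ I) {k : V} (hk : k ∈ I) (hkS : k ∉ S) (hkJ : k ∉ J)
    {z : AmbientField V} (h₁ : z ∈ Q.chart S J) (h₂ : z ∈ Q.chart S (insert k J)) :
    z ∈ Q.chart (insert k S) J := by
  have hg₁ : ∀ v, v ≠ k → Q.chartGens S (insert k J) v = Q.chartGens S J v := by
    intro v hv
    by_cases h : v ∈ S <;> by_cases h' : v ∈ J <;> simp [chartGens, hv, h, h']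
  have hg₂ : ∀ v, v ≠ k → Q.chartGens (insert k S) J v = Q.chartGens S J v := by
    intro v hv
    by_cases h : v ∈ S <;> by_cases h' : v ∈ J <;> simp [chartGens, hv, h, h']
  obtain ⟨C, hC⟩ : ∃ C, C = Subring.closure (⋃ v, ⋃ (_ : v ≠ k), Q.chartGens S J v) := ⟨_, rfl⟩
  have hle : ∀ S' J' : Finset V, (∀ v, v ≠ k → Q.chartGens S' J' v = Q.chartGens S J v) →
      Q.chart S' J' ≤ Subring.closure ((C : Set (AmbientField V)) ∪ Q.chartGens S' J' k) := by
    intro S' J' h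
    refine Subring.closure_le.2 (Set.iUnion_subset fun v a ha => ?_)
    by_cases hv : v = k
    · subst hv
      exact Subring.subset_closure (Or.inr ha)
    · rw [h v hv] at ha
      refine Subring.subset_closure (Or.inl ?_)
      rw [hC]
      exact Subring.subset_closure (Set.mem_iUnion₂.2 ⟨v, hv, ha⟩)
  have h₁' := hle _ _ (fun v _ => rfl) h₁
  have h₂' := hle _ _ hg₁ h₂
  have e₁ : Q.chartGens S J k = {ambientX k, (ambientX k)⁻¹} := by simp [chartGens, hkS, hkJ]
  have e₂ : Q.chartGens S (insert k J) k = {Q.mutatedX k, (Q.mutatedX k)⁻¹} := by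
    simp [chartGens, hkS]
  have e₃ : Q.chartGens (insert k S) J k = {ambientX k, Q.mutatedX k} := by simp [chartGens]
  rw [e₁] at h₁'
  rw [e₂] at h₂'
  have hp : Q.exchange ambientX k ∈ C := by
    refine exchange_mem _ _ fun i hi => ?_
    have hiI := hI.notMem hk hi
    have hik : i ≠ k := by rintro rfl; exact hiI hk
    rw [hC]
    refine Subring.subset_closure (Set.mem_iUnion₂.2 ⟨i, hik, ?_⟩)
    rw [chartGens, if_neg fun h => hiI (hS h), if_neg fun h => hiI (hJ h)]
    exact Or.inl rfl
  have hinj : Function.Injective (Polynomial.eval₂RingHom C.subtype (ambientX k)) := by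
    refine eval₂_ambientX_injective fun φ hφ c hc => ?_
    have hmut : ∀ v ∈ I, v ≠ k → φ (Q.mutatedX v) = Q.mutatedX v := by
      intro v hv hvk
      rw [mutatedX, map_div₀, hφ v hvk, map_exchange]
      congr 1
      refine exchange_congr (fun _ => rfl) (fun _ => rfl) fun i hi => hφ i ?_
      rintro rfl
      exact hI.notMem hv hi hk
    have : C ≤ φ.eqLocus (RingHom.id _) := by
      rw [hC]
      refine Subring.closure_le.2 (Set.iUnion₂_subset fun v hv a ha => ?_)
      change φ a = a
      rw [chartGens] at ha
      split_ifs at ha with hvS hvJ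
      · rcases ha with rfl | rfl
        · exact hφ v hv
        · exact hmut v (hS hvS) hv
      · rcases ha with rfl | rfl
        · exact hmut v (hJ hvJ) hv
        · rw [map_inv₀, hmut v (hJ hvJ) hv]
      · rcases ha with rfl | rfl
        · exact hφ v hv
        · rw [map_inv₀, hφ v hv]
    exact this hc
  have key := mem_closure_of_mem_of_mem C (ambientX_ne_zero k) (exchange_ambientX_ne_zero Q k) hp
    hinj h₁' h₂'
  change z ∈ Subring.closure ((C : Set (AmbientField V)) ∪ {ambientX k, Q.mutatedX k}) at key
  rw [← e₃] at key
  refine Subring.closure_le.2 ?_ key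
  refine Set.union_subset ?_ fun a ha => Subring.subset_closure (Set.mem_iUnion.2 ⟨k, ha⟩)
  rw [hC]
  refine Subring.closure_le.2 (Set.iUnion₂_subset fun v hv a ha => ?_)
  rw [← hg₂ v hv] at ha
  exact Subring.subset_closure (Set.mem_iUnion.2 ⟨v, ha⟩)

/-- The elements `x_v` for all `v`, `x_v'` for `v ∈ I` and `x_v⁻¹` for `v ∉ I` generate a ring that
contains the cluster algebra: for each subset `J` of `I`, all cluster variables are Laurent
polynomials in the cluster obtained by the mutations at the vertices of `J`. -/
theorem clusterAlgebra_le_chart {Q : IceQuiver V} {I : Finset V} (hI : Q.IsIndependent I) :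
    Q.clusterAlgebra ≤ Q.chart I ∅ := by
  classical
  refine Subring.closure_le.2 ?_
  rintro z (⟨T, hT, v, rfl⟩ | ⟨v, hv, rfl⟩)
  · obtain ⟨l, hl, rfl⟩ := Q.exists_eq_seedAt hT
    have key : ∀ S : Finset V, S ⊆ I → ∀ J : Finset V, J ⊆ I → Disjoint S J →
        (Q.seedAt l).cluster v ∈ Q.chart S J := by
      intro S
      induction S using Finset.induction_on with
      | empty =>
        intro _ J hJ _
        have h := seedAt_of_isIndependent hI J.nodup_toList fun k hk => hJ (by simpa using hk)
        have hz := Q.seedAt_cluster_mem_laurentRing (l := J.toList)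
          (fun k hk => (hI k (hJ (by simpa using hk))).1) hl v
        refine laurentRing_le (fun w => ?_) (fun w => ?_) hz <;>
        · rw [h.1 w]
          refine Subring.subset_closure (Set.mem_iUnion.2 ⟨w, ?_⟩)
          by_cases hw : w ∈ J <;> simp [chartGens, hw]
      | insert k S hkS ih =>
        intro hS J hJ hdisj
        rw [Finset.insert_subset_iff] at hS
        rw [Finset.disjoint_insert_left] at hdisj
        refine chart_insert hI hS.2 hJ hS.1 hkS hdisj.1 (ih hS.2 J hJ hdisj.2)
          (ih hS.2 _ (Finset.insert_subset hS.1 hJ) ?_)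
        rw [Finset.disjoint_insert_right]
        exact ⟨hkS, hdisj.2⟩
    exact key I subset_rfl ∅ (Finset.empty_subset _) (Finset.disjoint_empty_right _)
  · refine Subring.subset_closure (Set.mem_iUnion.2 ⟨v, ?_⟩)
    have : v ∉ I := fun h => hv (hI v h).1
    rw [chartGens, if_neg this, if_neg (by simp)]
    exact Or.inr rfl

end IceQuiver

/-! ### Points over the field with two elements -/

namespace IceQuiver

variable {V : Type*} [Fintype V]

/-- A solution in `𝔽₂` of the exchange relations of the initial seed: `val v` is the value of `x_v`
and `mutVal k` that of `x_k'`. The values of frozen variables are units, hence equal to `1`; at a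
frozen vertex `mutVal` has the dummy value `0`. -/
@[ext]
structure ExchangeSolution (Q : IceQuiver V) where
  val : V → ZMod 2
  mutVal : V → ZMod 2
  val_frozen : ∀ v, ¬ Q.Mutable v → val v = 1
  mutVal_frozen : ∀ v, ¬ Q.Mutable v → mutVal v = 0
  relation : ∀ k, Q.Mutable k → val k * mutVal k = Q.exchange val k

instance (Q : IceQuiver V) : Finite Q.ExchangeSolution :=
  Finite.of_injective (fun p => (p.val, p.mutVal)) fun p q h => by
    rw [Prod.mk.injEq] at h
    exact ExchangeSolution.ext h.1 h.2

theorem ambientX_mem_clusterAlgebra (Q : IceQuiver V) (v : V) :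
    ambientX v ∈ Q.clusterAlgebra :=
  Subring.subset_closure (Or.inl ⟨_, .refl, v, rfl⟩)

theorem inv_ambientX_mem_clusterAlgebra (Q : IceQuiver V) {v : V} (hv : ¬ Q.Mutable v) :
    (ambientX v)⁻¹ ∈ Q.clusterAlgebra :=
  Subring.subset_closure (Or.inr ⟨v, hv, rfl⟩)

theorem mutatedX_mem_clusterAlgebra (Q : IceQuiver V) {k : V} (hk : Q.Mutable k) :
    Q.mutatedX k ∈ Q.clusterAlgebra :=
  Subring.subset_closure (Or.inl ⟨_, Q.reflTransGen_seedAt [k] (by simpa using hk), k,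
    (Q.seedAt_singleton_cluster_self k).symm⟩)

theorem eq_one_of_ne_zero_zmod_two {a : ZMod 2} (h : a ≠ 0) : a = 1 := by
  revert a; decide

open Classical in
/-- The solution of the exchange relations that is given by a point of the cluster algebra. -/
noncomputable def solutionOfHom (Q : IceQuiver V) (φ : Q.clusterAlgebra →+* ZMod 2) :
    Q.ExchangeSolution where
  val v := φ ⟨ambientX v, Q.ambientX_mem_clusterAlgebra v⟩
  mutVal v := if h : Q.Mutable v then φ ⟨Q.mutatedX v, Q.mutatedX_mem_clusterAlgebra h⟩ else 0
  val_frozen v hv := by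
    apply eq_one_of_ne_zero_zmod_two
    intro h0
    have e : (⟨ambientX v, Q.ambientX_mem_clusterAlgebra v⟩ : Q.clusterAlgebra) *
        ⟨_, Q.inv_ambientX_mem_clusterAlgebra hv⟩ = 1 :=
      Subtype.ext (mul_inv_cancel₀ (ambientX_ne_zero v))
    have := congrArg φ e
    rw [map_mul, h0, zero_mul, map_one] at this
    exact zero_ne_one this
  mutVal_frozen v hv := dif_neg hv
  relation k hk := by
    rw [dif_pos hk, ← map_mul, ← map_exchange]
    congr 1
    apply Subtype.ext
    have := map_exchange Q.clusterAlgebra.subtype Q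
      (fun v => ⟨ambientX v, Q.ambientX_mem_clusterAlgebra v⟩) k
    refine Eq.trans ?_ this.symm
    change ambientX k * (Q.exchange ambientX k / ambientX k) = Q.exchange ambientX k
    rw [mul_div_cancel₀ _ (ambientX_ne_zero k)]

open Classical in
/-- The vertices at which a solution vanishes. -/
noncomputable def ExchangeSolution.zeros {Q : IceQuiver V} (p : Q.ExchangeSolution) : Finset V :=
  Finset.univ.filter fun v => p.val v = 0

theorem ExchangeSolution.mem_zeros {Q : IceQuiver V} (p : Q.ExchangeSolution) {v : V} :
    v ∈ p.zeros ↔ p.val v = 0 := by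
  simp [zeros]

theorem ExchangeSolution.mutable_of_val_eq_zero {Q : IceQuiver V} (p : Q.ExchangeSolution) {v : V}
    (h : p.val v = 0) : Q.Mutable v := by
  by_contra hv
  rw [p.val_frozen v hv] at h
  exact one_ne_zero h

/-- The zeros of a solution are pairwise non-adjacent. If `x_k` and some `x_j` with `k → j` vanish,
then by the exchange relation at `k` also some `x_i` with `i → k` vanishes. In an acyclic quiver,
this descent along the arrows has to stop. -/
theorem ExchangeSolution.isIndependent_zeros {Q : IceQuiver V} (hQ : Q.Acyclic)
    (p : Q.ExchangeSolution) : Q.IsIndependent p.zeros := by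
  have key : ∀ k, p.val k = 0 → ∀ j, p.val j = 0 → Q.arr k j = 0 := by
    let r : V → V → Prop := Relation.TransGen fun i j => Q.Mutable i ∧ Q.Mutable j ∧ 0 < Q.arr i j
    have : IsTrans V r := ⟨fun _ _ _ => Relation.TransGen.trans⟩
    have : Std.Irrefl r := ⟨hQ⟩
    have hwf : WellFounded r := Finite.wellFounded_of_trans_of_irrefl r
    intro k
    induction k using hwf.induction with
    | _ k ih =>
      intro hk j hj
      by_contra hkj
      have hm := p.mutable_of_val_eq_zero hk
      have h := p.relation k hm
      have hout : ∏ j, p.val j ^ Q.arr k j = 0 :=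
        Finset.prod_eq_zero (Finset.mem_univ j) (by rw [hj, zero_pow hkj])
      rw [hk, zero_mul, exchange, hout, zero_add, eq_comm, Finset.prod_eq_zero_iff] at h
      obtain ⟨i, -, hi⟩ := h
      have hi0 := eq_zero_of_pow_eq_zero hi
      have hik : Q.arr i k ≠ 0 := by
        intro h0
        rw [h0, pow_zero] at hi
        exact one_ne_zero hi
      exact hik (ih i (.single ⟨p.mutable_of_val_eq_zero hi0, hm, Nat.pos_of_ne_zero hik⟩)
        hi0 k hk)
  intro k hk
  rw [p.mem_zeros] at hk
  exact ⟨p.mutable_of_val_eq_zero hk, fun l hl => key k hk l (p.mem_zeros.1 hl)⟩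

theorem solutionOfHom_injective {Q : IceQuiver V} (hQ : Q.Acyclic) :
    Function.Injective Q.solutionOfHom := by
  classical
  intro φ φ' h
  have hI := (Q.solutionOfHom φ).isIndependent_zeros hQ
  obtain ⟨I, hId⟩ : ∃ I, I = (Q.solutionOfHom φ).zeros := ⟨_, rfl⟩
  rw [← hId] at hI
  let E : Subring (AmbientField V) := (φ.eqLocus φ').map Q.clusterAlgebra.subtype
  have hE : ∀ v, ambientX v ∈ E := fun v =>
    ⟨⟨ambientX v, Q.ambientX_mem_clusterAlgebra v⟩,
      congrFun (congrArg ExchangeSolution.val h) v, rfl⟩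
  have hE' : ∀ v ∈ I, Q.mutatedX v ∈ E := by
    intro v hv
    have hv' := (hI v hv).1
    refine ⟨⟨Q.mutatedX v, Q.mutatedX_mem_clusterAlgebra hv'⟩, ?_, rfl⟩
    have := congrFun (congrArg ExchangeSolution.mutVal h) v
    simp only [solutionOfHom] at this
    rwa [dif_pos hv', dif_pos hv'] at this
  -- A monomial with value `1` that becomes invertible in the chart of the zero set.
  have hM : ∏ v ∈ Iᶜ, ambientX v ∈ E := prod_mem fun v _ => hE v
  have hle : Q.chart I ∅ ≤ awayRing E _ hM := by
    refine Subring.closure_le.2 (Set.iUnion_subset fun v z hz => ?_)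
    rw [chartGens] at hz
    split_ifs at hz with hv hv'
    · rcases hz with rfl | rfl
      · exact le_awayRing hM (hE v)
      · exact le_awayRing hM (hE' v hv)
    · simp at hv'
    · rcases hz with rfl | rfl
      · exact le_awayRing hM (hE v)
      · refine ⟨1, ?_⟩
        rw [pow_one, ← Finset.mul_prod_erase _ _ (Finset.mem_compl.2 hv), mul_comm, ← mul_assoc,
          inv_mul_cancel₀ (ambientX_ne_zero v), one_mul]
        exact prod_mem fun v _ => hE v
  have hone : ∀ ψ : Q.clusterAlgebra →+* ZMod 2, Q.solutionOfHom ψ = Q.solutionOfHom φ →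
      ψ (∏ v ∈ Iᶜ, ⟨ambientX v, Q.ambientX_mem_clusterAlgebra v⟩) = 1 := by
    intro ψ hψ
    rw [map_prod]
    refine Finset.prod_eq_one fun v hv => eq_one_of_ne_zero_zmod_two ?_
    rw [Finset.mem_compl, hId, ExchangeSolution.mem_zeros, ← hψ] at hv
    exact hv
  ext z
  obtain ⟨n, e, he, hez⟩ := hle (clusterAlgebra_le_chart hI z.2)
  have hez' : e = (∏ v ∈ Iᶜ, ⟨ambientX v, Q.ambientX_mem_clusterAlgebra v⟩) ^ n * z := by
    apply Subtype.ext
    refine Eq.trans hez ?_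
    simp
  have he' : φ e = φ' e := he
  rw [hez', map_mul, map_mul, map_pow, map_pow, hone φ rfl, hone φ' h.symm, one_pow, one_mul,
    one_mul] at he'
  exact he'

theorem exists_hom_of_le_specializingTo {V : Type*} {L G : Type*} [Field L] [CommRing G] {s : V → L}
    {f : G →+* L} (hf : Function.Injective f) {A : Subring (AmbientField V)}
    (h : A ≤ specializingTo s f.range) :
    ∃ φ : A →+* G, ∀ z : A, Specializes s z (f (φ z)) := by
  have h' : ∀ z : A, ∃ g, Specializes s z (f g) := by
    intro z
    obtain ⟨_, ⟨g, rfl⟩, hs⟩ := h z.2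
    exact ⟨g, hs⟩
  choose φ hφ using h'
  refine ⟨⟨⟨⟨φ, ?_⟩, ?_⟩, ?_, ?_⟩, hφ⟩
  · apply hf
    rw [map_one]
    exact (hφ 1).unique .one
  · intro a b
    apply hf
    change f (φ (a * b)) = f (φ a * φ b)
    rw [map_mul]
    exact (hφ _).unique ((hφ a).mul (hφ b))
  · apply hf
    change f (φ 0) = f 0
    rw [map_zero]
    exact (hφ 0).unique .zero
  · intro a b
    apply hf
    change f (φ (a + b)) = f (φ a + φ b)
    rw [map_add]
    exact (hφ _).unique ((hφ a).add (hφ b))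

/-- Every solution of the exchange relations comes from a point. The points where `x_k` and `x_k'`
both vanish do not lie in a cluster torus over `𝔽₂`, but the solution can be lifted to the Gaussian
integers: set `x_v = 1` where the solution does not vanish, so that the exchange polynomials at the
zeros become `2`, and there let `(x_k, x_k')` be `(2, 1)` or `(1 + i, 1 - i)`. -/
theorem solutionOfHom_surjective {Q : IceQuiver V} (hQ : Q.Acyclic) :
    Function.Surjective Q.solutionOfHom := by
  classical
  intro p
  have hI := p.isIndependent_zeros hQ
  let g : V → GaussianInt := fun v =>
    if p.val v = 0 then (if p.mutVal v = 0 then ⟨1, 1⟩ else 2) else 1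
  let g' : V → GaussianInt := fun v => if p.mutVal v = 0 then ⟨1, -1⟩ else 1
  let red : GaussianInt →+* ZMod 2 := Zsqrtd.lift ⟨1, by decide⟩
  have hred2 : red 2 = 0 := by rw [map_ofNat]; rfl
  have hred : ∀ v, red (g v) = p.val v := by
    intro v
    simp only [g]
    split_ifs with h h'
    · rw [h]; simp [red, Zsqrtd.lift]; decide
    · rw [h, hred2]
    · rw [map_one, eq_one_of_ne_zero_zmod_two h]
  have hred' : ∀ v, red (g' v) = p.mutVal v := by
    intro v
    simp only [g']
    split_ifs with h
    · rw [h]; simp [red, Zsqrtd.lift]; decide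
    · rw [map_one, eq_one_of_ne_zero_zmod_two h]
  have hgg' : ∀ v, p.val v = 0 → g v * g' v = 2 := by
    intro v hv
    simp only [g, g', hv, if_true]
    split_ifs
    · ext <;> simp
    · ring
  have hg0 : ∀ v, g v ≠ 0 := by
    intro v
    simp only [g]
    split_ifs
    · intro h; simpa using congrArg Zsqrtd.re h
    · exact two_ne_zero
    · exact one_ne_zero
  have hinj : Function.Injective GaussianInt.toComplex := fun a b h =>
    GaussianInt.toComplex_inj.1 h
  obtain ⟨s, hs⟩ : ∃ s : V → ℂ, ∀ v, s v = GaussianInt.toComplex (g v) := ⟨_, fun _ => rfl⟩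
  have hs0 : ∀ v, s v ≠ 0 := fun v h => hg0 v (hinj (by rw [← hs, h, map_zero]))
  have hX := fun v => Specializes.ambientX (s := s) v
  have hP : ∀ k, Specializes s (Q.mutatedX k) (GaussianInt.toComplex (Q.exchange g k) / s k) := by
    intro k
    rw [map_exchange, ← funext hs]
    exact (Specializes.exchange Q hX k).div (hX k) (hs0 k)
  have hP' : ∀ k ∈ p.zeros, Specializes s (Q.mutatedX k) (GaussianInt.toComplex (g' k)) := by
    intro k hk
    have hk0 := p.mem_zeros.1 hk
    have e : Q.exchange g k = g k * g' k := by
      have : Q.exchange g k = Q.exchange (fun _ => 1) k := by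
        refine exchange_congr (fun _ => rfl) (fun _ => rfl) fun i hi => if_neg ?_
        rw [← p.mem_zeros]
        exact hI.notMem hk hi
      rw [this, hgg' k hk0]
      simp only [exchange, one_pow, Finset.prod_const_one]
      norm_num
    have := hP k
    rwa [e, map_mul, ← hs, mul_div_cancel_left₀ _ (hs0 k)] at this
  have hle : Q.chart p.zeros ∅ ≤ specializingTo s GaussianInt.toComplex.range := by
    refine Subring.closure_le.2 (Set.iUnion_subset fun v z hz => ?_)
    rw [chartGens] at hz
    split_ifs at hz with hv hv'
    · rcases hz with rfl | rfl
      · exact ⟨_, ⟨g v, (hs v).symm⟩, hX v⟩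
      · exact ⟨_, ⟨g' v, rfl⟩, hP' v hv⟩
    · simp at hv'
    · have hv1 : g v = 1 := if_neg (by rwa [← p.mem_zeros])
      have hXv := hX v
      rw [hs, hv1, map_one] at hXv
      rcases hz with rfl | rfl
      · exact ⟨1, one_mem _, hXv⟩
      · exact ⟨1, one_mem _, by simpa using hXv.inv one_ne_zero⟩
  obtain ⟨φ, hφ⟩ := exists_hom_of_le_specializingTo hinj
    ((clusterAlgebra_le_chart hI).trans hle)
  have hφX : ∀ v, φ ⟨ambientX v, Q.ambientX_mem_clusterAlgebra v⟩ = g v := by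
    intro v
    apply hinj
    rw [← hs]
    exact (hφ _).unique (hX v)
  refine ⟨red.comp φ, ?_⟩
  ext v
  · change red (φ _) = _
    rw [hφX, hred]
  · by_cases hv : Q.Mutable v
    · simp only [solutionOfHom, dif_pos hv, RingHom.comp_apply]
      by_cases h0 : p.val v = 0
      · rw [← hred' v]
        congr 1
        exact hinj ((hφ _).unique (hP' v (p.mem_zeros.2 h0)))
      · have e : φ ⟨Q.mutatedX v, Q.mutatedX_mem_clusterAlgebra hv⟩ = Q.exchange g v := by
          apply hinj
          have := (hφ ⟨Q.mutatedX v, Q.mutatedX_mem_clusterAlgebra hv⟩).unique (hP v)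
          rwa [hs, show g v = 1 from if_neg h0, map_one, div_one] at this
        rw [e, map_exchange, funext hred, ← p.relation v hv, eq_one_of_ne_zero_zmod_two h0,
          one_mul]
    · rw [p.mutVal_frozen v hv]
      exact dif_neg hv

/-- For an acyclic quiver, the points of the cluster variety over `𝔽₂` are the solutions of the
exchange relations of the initial seed. -/
noncomputable def clusterVarietyEquiv {Q : IceQuiver V} (hQ : Q.Acyclic) :
    Q.ClusterVariety (ZMod 2) ≃ Q.ExchangeSolution :=
  ((AlgHom.liftEquiv ℤ (ZMod 2) Q.clusterAlgebra (ZMod 2)).symm.trans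
    (RingHom.equivIntAlgHom (R := Q.clusterAlgebra) (S := ZMod 2)).symm).trans
    (Equiv.ofBijective _ ⟨solutionOfHom_injective hQ, solutionOfHom_surjective hQ⟩)

end IceQuiver

/-! ### Counting the solutions of the exchange relations -/

namespace IceQuiver

variable {V : Type*}

/-- The vertex `v` is different from `x` and not adjacent to it. -/
def IsFar (Q : IceQuiver V) (x v : V) : Prop :=
  v ≠ x ∧ Q.arr v x = 0 ∧ Q.arr x v = 0

theorem Acyclic.restrict {Q : IceQuiver V} (hQ : Q.Acyclic) (g : V → Prop) :
    (Q.restrict g).Acyclic := fun v h =>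
  hQ v (Relation.TransGen.lift (r := fun i j => (Q.restrict g).Mutable i ∧
    (Q.restrict g).Mutable j ∧ 0 < (Q.restrict g).arr i j)
    (fun v : {v // g v} => (v : V)) (fun _ _ h => h) _ _ h)

variable [Fintype V]

theorem exchange_restrict (Q : IceQuiver V) {g : V → Prop} [Fintype {v // g v}] {R : Type*}
    [CommSemiring R] {a : V → R} {b : {v // g v} → R} (hab : ∀ v : {v // g v}, a v = b v)
    {k : {v // g v}} (h : ∀ u, ¬ g u → a u = 1 ∨ Q.arr u k = 0 ∧ Q.arr k u = 0) :
    (Q.restrict g).exchange b k = Q.exchange a k := by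
  classical
  have key : ∀ e : V → ℕ, (∀ u, ¬ g u → a u = 1 ∨ e u = 0) →
      ∏ u : {v // g v}, b u ^ e u = ∏ u, a u ^ e u := by
    intro e he
    have h1 : ∏ u ∈ Finset.univ.filter g, a u ^ e u = ∏ u, a u ^ e u := by
      refine Finset.prod_subset (Finset.filter_subset _ _) fun u _ hu => ?_
      rcases he u (by simpa using hu) with h | h <;> simp [h]
    rw [← h1, Finset.prod_subtype (p := g) (Finset.univ.filter g) (by simp)]
    exact Finset.prod_congr rfl fun u _ => by rw [hab]
  unfold exchange
  congr 1
  · exact key (fun u => Q.arr k u) fun u hu => (h u hu).imp_right And.right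
  · exact key (fun u => Q.arr u k) fun u hu => (h u hu).imp_right And.left

theorem prod_pow_eq_one_iff (a : V → ZMod 2) (e : V → ℕ) :
    ∏ v, a v ^ e v = 1 ↔ ∀ v, e v ≠ 0 → a v = 1 := by
  constructor
  · intro h v hv
    apply eq_one_of_ne_zero_zmod_two
    intro h0
    rw [Finset.prod_eq_zero (Finset.mem_univ v) (by rw [h0, zero_pow hv])] at h
    exact zero_ne_one h
  · intro h
    refine Finset.prod_eq_one fun v _ => ?_
    by_cases hv : e v = 0
    · rw [hv, pow_zero]
    · rw [h v hv, one_pow]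

/-- At a sink or a source of the mutable part, one of the two terms of the exchange polynomial is a
monomial in frozen variables, hence equal to `1`. So over `𝔽₂` the polynomial vanishes if and only
if the variables of all neighbors are `1`. -/
theorem exchange_eq_zero_iff {Q : IceQuiver V} {x : V}
    (hx : Q.IsMutableSink x ∨ Q.IsMutableSource x) {a : V → ZMod 2}
    (ha : ∀ v, ¬ Q.Mutable v → a v = 1) :
    Q.exchange a x = 0 ↔ ∀ v, Q.arr v x ≠ 0 ∨ Q.arr x v ≠ 0 → a v = 1 := by
  have two : ∀ t : ZMod 2, 1 + t = 0 ↔ t = 1 := by decide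
  rcases hx with hx | hx
  · have h1 : ∀ v, Q.arr x v ≠ 0 → a v = 1 := fun v hv => ha v fun hm => hv (hx.2 v hm)
    rw [exchange, (prod_pow_eq_one_iff a _).2 h1, two, prod_pow_eq_one_iff]
    exact ⟨fun h v hv => hv.elim (h v) (h1 v), fun h v hv => h v (Or.inl hv)⟩
  · have h1 : ∀ v, Q.arr v x ≠ 0 → a v = 1 := fun v hv => ha v fun hm => hv (hx.2 v hm)
    rw [exchange, (prod_pow_eq_one_iff a fun j => Q.arr j x).2 h1, add_comm, two,
      prod_pow_eq_one_iff]
    exact ⟨fun h v hv => hv.elim (h1 v) (h v), fun h v hv => h v (Or.inr hv)⟩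

namespace ExchangeSolution

open Classical in
/-- The extension by `b` of a function on a set of vertices. -/
noncomputable def extendVal {V : Type*} (g : V → Prop) (q : {v // g v} → ZMod 2)
    (b : V → ZMod 2) (v : V) : ZMod 2 :=
  if h : g v then q ⟨v, h⟩ else b v

theorem extendVal_of_pos {V : Type*} (g : V → Prop) (q : {v // g v} → ZMod 2)
    (b : V → ZMod 2) {v : V} (h : g v) :
    extendVal g q b v = q ⟨v, h⟩ := dif_pos h

theorem extendVal_of_neg {V : Type*} (g : V → Prop) (q : {v // g v} → ZMod 2)
    (b : V → ZMod 2) {v : V} (h : ¬ g v) :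
    extendVal g q b v = b v := dif_neg h

variable {Q : IceQuiver V} {g : V → Prop} [Fintype {v // g v}]

/-- The restriction of a solution to a set of vertices such that the other vertices have the value
`1` or are not adjacent to it. -/
def restrict (p : Q.ExchangeSolution)
    (h : ∀ u, ¬ g u → p.val u = 1 ∨ ∀ v, g v → Q.arr u v = 0 ∧ Q.arr v u = 0) :
    (Q.restrict g).ExchangeSolution where
  val v := p.val v
  mutVal v := p.mutVal v
  val_frozen v hv := p.val_frozen v hv
  mutVal_frozen v hv := p.mutVal_frozen v hv
  relation k hk := (p.relation k hk).trans
    (Q.exchange_restrict (fun _ => rfl) fun u hu => (h u hu).imp_right fun h => h k k.2).symm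

/-- The extension of a solution to the whole quiver, with the values `b` and `c` at the new
vertices. -/
noncomputable def extend (q : (Q.restrict g).ExchangeSolution) (b c : V → ZMod 2)
    (hb : ∀ u, ¬ g u → b u = 1 ∨ ∀ v, g v → Q.arr u v = 0 ∧ Q.arr v u = 0)
    (hbf : ∀ u, ¬ g u → ¬ Q.Mutable u → b u = 1) (hcf : ∀ u, ¬ g u → ¬ Q.Mutable u → c u = 0)
    (hbc : ∀ u, ¬ g u → Q.Mutable u → b u * c u = Q.exchange (extendVal g q.val b) u) :
    Q.ExchangeSolution where
  val := extendVal g q.val b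
  mutVal := extendVal g q.mutVal c
  val_frozen v hv := by
    by_cases h : g v
    · rw [extendVal_of_pos g _ _ h]; exact q.val_frozen ⟨v, h⟩ hv
    · rw [extendVal_of_neg g _ _ h]; exact hbf v h hv
  mutVal_frozen v hv := by
    by_cases h : g v
    · rw [extendVal_of_pos g _ _ h]; exact q.mutVal_frozen ⟨v, h⟩ hv
    · rw [extendVal_of_neg g _ _ h]; exact hcf v h hv
  relation v hv := by
    by_cases h : g v
    · rw [extendVal_of_pos g _ _ h, extendVal_of_pos g _ _ h]
      refine (q.relation ⟨v, h⟩ hv).trans (Q.exchange_restrict (k := ⟨v, h⟩)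
        (fun w => extendVal_of_pos g _ _ w.2) fun u hu => ?_)
      rw [extendVal_of_neg g _ _ hu]
      exact (hb u hu).imp_right fun h' => h' v h
    · rw [extendVal_of_neg g _ _ h, extendVal_of_neg g _ _ h]
      exact hbc v h hv

/-- The solutions with value `1` at the mutable vertex `x` are the solutions for `Q^{-x}`. -/
noncomputable def equivDeleteVertex {x : V} (hx : Q.Mutable x) [Fintype {v // v ≠ x}] :
    {p : Q.ExchangeSolution // p.val x = 1} ≃ (Q.deleteVertex x).ExchangeSolution where
  toFun p := p.1.restrict (g := fun v => v ≠ x) fun u hu => Or.inl (by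
    rw [not_not.1 hu, p.2])
  invFun q := ⟨extend (g := fun v => v ≠ x) q (fun _ => 1)
    (fun _ => Q.exchange (extendVal (fun v => v ≠ x) q.val fun _ => 1) x) (fun _ _ => Or.inl rfl)
    (fun _ _ _ => rfl)
    (fun u hu hu' => absurd hx (by rwa [← not_not.1 hu]))
    (fun u hu _ => by rw [one_mul, not_not.1 hu]),
    extendVal_of_neg (fun v => v ≠ x) q.val (fun _ => 1) (not_not.2 rfl)⟩
  left_inv p := by
    have hval : extendVal (fun v => v ≠ x) (fun v => p.1.val v) (fun _ => 1) = p.1.val := by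
      funext v
      by_cases h : v = x
      · rw [extendVal_of_neg (fun v => v ≠ x) _ _ (not_not.2 h), h, p.2]
      · rw [extendVal_of_pos (fun v => v ≠ x) _ _ h]
    apply Subtype.ext
    apply ExchangeSolution.ext
    · exact hval
    · funext v
      dsimp only [restrict, extend]
      by_cases h : v = x
      · refine (extendVal_of_neg (fun v => v ≠ x) _ _ (not_not.2 h)).trans ?_
        change Q.exchange (extendVal (fun v => v ≠ x) (fun v => p.1.val v) fun _ => 1) x = _
        rw [hval, ← p.1.relation x hx, p.2, one_mul, h]
      · exact extendVal_of_pos (fun v => v ≠ x) _ _ h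
  right_inv q := by
    apply ExchangeSolution.ext <;> funext v <;> dsimp only [restrict, extend]
    · exact extendVal_of_pos (fun v => v ≠ x) _ _ v.2
    · exact extendVal_of_pos (fun v => v ≠ x) _ _ v.2

open Classical in
/-- If `x` is a sink or a source, then a solution that vanishes at `x` has the value `1` at the
neighbors of `x`, so that it is a solution for `Q^{-N(x)}`, and the value of `x'` is arbitrary. -/
noncomputable def equivDeleteNeighbors {x : V} (hx : Q.IsMutableSink x ∨ Q.IsMutableSource x)
    [Fintype {v // Q.IsFar x v}] :
    {p : Q.ExchangeSolution // ¬ p.val x = 1} ≃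
      ZMod 2 × (Q.restrict (Q.IsFar x)).ExchangeSolution :=
  have hxm : Q.Mutable x := hx.elim And.left And.left
  have hgx : ¬ Q.IsFar x x := fun h => h.1 rfl
  have hadj : ∀ {u}, ¬ Q.IsFar x u → u ≠ x →
      Q.arr u x ≠ 0 ∨ Q.arr x u ≠ 0 := fun {u} hu hux => by
    unfold IsFar at hu
    tauto
  have hzero : ∀ p : {p : Q.ExchangeSolution // ¬ p.val x = 1}, p.1.val x = 0 := fun p =>
    not_not.1 fun h => p.2 (eq_one_of_ne_zero_zmod_two h)
  have hone : ∀ (p : {p : Q.ExchangeSolution // ¬ p.val x = 1}) {u},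
      ¬ Q.IsFar x u → u ≠ x → p.1.val u = 1 := fun p u hu hux =>
    (exchange_eq_zero_iff hx p.1.val_frozen).1
      (by rw [← p.1.relation x hxm, hzero p, zero_mul]) u (hadj hu hux)
  { toFun := fun p => (p.1.mutVal x,
      p.1.restrict (g := Q.IsFar x) fun u hu => by
        by_cases hux : u = x
        · right
          rintro v ⟨-, h1, h2⟩
          rw [hux]
          exact ⟨h2, h1⟩
        · exact Or.inl (hone p hu hux))
    invFun := fun q => ⟨extend (g := Q.IsFar x) q.2
      (fun u => if u = x then 0 else 1)
      (fun u => if u = x then q.1 else if Q.Mutable u then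
        Q.exchange (extendVal (Q.IsFar x) q.2.val fun u => if u = x then 0 else 1) u else 0)
      (fun u hu => by
        by_cases hux : u = x
        · right
          rintro v ⟨-, h1, h2⟩
          rw [hux]
          exact ⟨h2, h1⟩
        · exact Or.inl (if_neg hux))
      (fun u hu hm => if_neg (by rintro rfl; exact hm hxm))
      (fun u hu hm => by
        rw [if_neg (by rintro rfl; exact hm hxm), if_neg hm])
      (fun u hu hm => by
        by_cases hux : u = x
        · rw [if_pos hux, zero_mul, hux, eq_comm, exchange_eq_zero_iff hx]
          · intro v hv
            have hvx : v ≠ x := by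
              rintro rfl
              simp [Q.no_loop] at hv
            refine (extendVal_of_neg (Q.IsFar x) _ _ ?_).trans (if_neg hvx)
            rintro ⟨-, h1, h2⟩
            exact hv.elim (· h1) (· h2)
          · intro v hv
            by_cases h : Q.IsFar x v
            · exact (extendVal_of_pos (Q.IsFar x) _ _ h).trans (q.2.val_frozen ⟨v, h⟩ hv)
            · exact (extendVal_of_neg (Q.IsFar x) _ _ h).trans
                (if_neg fun h' => hv (by rw [h']; exact hxm))
        · rw [if_neg hux, if_neg hux, if_pos hm, one_mul]),
      by
        have : extendVal (Q.IsFar x) q.2.val (fun u => if u = x then 0 else 1) x = 0 :=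
          (extendVal_of_neg (Q.IsFar x) _ _ hgx).trans (if_pos rfl)
        intro h
        exact zero_ne_one (this.symm.trans h)⟩
    left_inv := fun p => by
      have hval : extendVal (Q.IsFar x)
          (fun v => p.1.val v) (fun u => if u = x then 0 else 1) = p.1.val := by
        funext v
        by_cases h : Q.IsFar x v
        · exact extendVal_of_pos (Q.IsFar x) _ _ h
        · refine (extendVal_of_neg (Q.IsFar x) _ _ h).trans ?_
          split_ifs with hvx
          · rw [hvx, hzero p]
          · exact (hone p h hvx).symm
      apply Subtype.ext
      apply ExchangeSolution.ext
      · exact hval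
      · funext v
        dsimp only [restrict, extend]
        by_cases h : Q.IsFar x v
        · exact extendVal_of_pos (Q.IsFar x) _ _ h
        · refine (extendVal_of_neg (Q.IsFar x) _ _ h).trans ?_
          rw [hval]
          split_ifs with hvx hm
          · rw [hvx]
          · rw [← p.1.relation v hm, hone p h hvx, one_mul]
          · rw [p.1.mutVal_frozen v hm]
    right_inv := fun q => by
      refine Prod.ext ?_ ?_
      · exact (extendVal_of_neg (Q.IsFar x) _ (fun u => if u = x then q.1 else _) hgx).trans
          (if_pos rfl)
      apply ExchangeSolution.ext <;> funext v <;> dsimp only [restrict, extend]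
      · exact extendVal_of_pos (Q.IsFar x) _ _ v.2
      · exact extendVal_of_pos (Q.IsFar x) _ _ v.2 }

end ExchangeSolution

end IceQuiver

theorem lemma1p1 {V : Type*} [Fintype V] [DecidableEq V] (Q : IceQuiver V) (hQ : Q.Acyclic)
    (x : V) (hx : Q.IsMutableSink x ∨ Q.IsMutableSource x) :
    Finite (Q.ClusterVariety (ZMod 2)) ∧
    Finite ((Q.deleteVertex x).ClusterVariety (ZMod 2)) ∧
    Finite ((Q.deleteNeighbors x).ClusterVariety (ZMod 2)) ∧
    Nat.card (Q.ClusterVariety (ZMod 2)) =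
      Nat.card ((Q.deleteVertex x).ClusterVariety (ZMod 2)) +
        2 * Nat.card ((Q.deleteNeighbors x).ClusterVariety (ZMod 2)) := by
  have e := IceQuiver.clusterVarietyEquiv hQ
  have e₁ := IceQuiver.clusterVarietyEquiv (Q := Q.deleteVertex x) (hQ.restrict _)
  have e₂ := IceQuiver.clusterVarietyEquiv (Q := Q.deleteNeighbors x) (hQ.restrict _)
  refine ⟨.of_equiv _ e.symm, .of_equiv _ e₁.symm, .of_equiv _ e₂.symm, ?_⟩
  let _ : Fintype {v // Q.IsFar x v} :=
    inferInstanceAs (Fintype {v // v ≠ x ∧ Q.arr v x = 0 ∧ Q.arr x v = 0})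
  have h : Nat.card {p : Q.ExchangeSolution // ¬ p.val x = 1} =
      Nat.card (ZMod 2 × (Q.deleteNeighbors x).ExchangeSolution) :=
    Nat.card_congr (IceQuiver.ExchangeSolution.equivDeleteNeighbors hx)
  rw [Nat.card_congr e, Nat.card_congr e₁, Nat.card_congr e₂,
    ← Nat.card_congr (Equiv.sumCompl fun p : Q.ExchangeSolution => p.val x = 1), Nat.card_sum,
    Nat.card_congr (IceQuiver.ExchangeSolution.equivDeleteVertex (hx.elim And.left And.left)), h,
    Nat.card_prod, Nat.card_zmod]
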